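/- Let $d\ge 0$ and let $\mathcal F(\mathbb R^d)$ be the manifold of complete flags $F=(F^1\subset\dots\subset F^{d-1})$ of $\mathbb R^d$, where $\dim F^k=k$ (and $F^0=0$, $F^d=\mathbb R^d$), with its usual topology as a homogeneous space of $\mathrm{GL}_d(\mathbb R)$. Flags $F,G$ are transverse if $F^k+G^{d-k}=\mathbb R^d$ for all $k$. An upper triangular unipotent matrix is totally positive if all its minors that are not forced to vanish by upper triangularity (those with rows $i_1<\dots<i_k$ and columns $j_1<\dots<j_k$ satisfying $i_p\le j_p$ for all $p$) are positive. For a basis $\mathcal B=(e_1,\dots,e_d)$ of $\mathbb R^d$, let $U_{>0}(\mathcal B)\subset \mathrm{PGL}_d(\mathbb R)$ be the set of elements represented in the basis $\mathcal B$ by an upper triangular, unipotent, totally positive matrix. For $n\ge 3$, an $n$-tuple of complete flags $(F_1,\dots,F_n)$ is positive if $F_1$ and $F_n$ are transverse and there are a basis $\mathcal B=(e_1,\dots,e_d)$ of $\mathbb R^d$ and elements $u_2,\dots,u_{n-1}\in U_{>0}(\mathcal B)$ such that $e_i\in F_1^i\cap F_n^{d-i+1}$ for all $1\le i\le d$ and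 $F_j=(u_{n-1}\cdots u_j)\cdot F_n$ for all $2\le j\le n-1$. A map $\xi:\mathbb S^1\to\mathcal F(\mathbb R^d)$ is transverse if $\xi(x)$ and $\xi(y)$ are transverse whenever $x\ne y$. It is positive if for every integer $n\ge3$ and all pairwise distinct points $a_1,\dots,a_n\in\mathbb S^1$ that occur in this clockwise cyclic order, the tuple $(\xi(a_1),\dots,\xi(a_n))$ is positive. **Proposition.** Let $\xi:\mathbb S^1\to\mathcal F(\mathbb R^d)$ be a continuous, transverse map. If there are pairwise distinct points $x,y,z\in\mathbb S^1$ such that the triple $(\xi(x),\xi(y),\xi(z))$ is positive, then $\xi$ is a positive map. -/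

import Mathlib

noncomputable section

/-- A complete flag of `ℝ^d`: a nested sequence of subspaces `F 0 ≤ F 1 ≤ ⋯ ≤ F d` of `ℝ^d`
with `dim (F k) = k`. The terms `F 0 = 0` and `F d = ℝ^d` are included for convenience. -/
@[ext]
structure CompleteFlag (d : ℕ) where
  /-- The `k`-dimensional term of the flag. -/
  space : Fin (d + 1) → Submodule ℝ (Fin d → ℝ)
  mono : Monotone space
  finrank_space : ∀ k, Module.finrank ℝ (space k) = (k : ℕ)

namespace CompleteFlag

variable {d : ℕ}

theorem finrank_basis_flag (b : Module.Basis (Fin d) ℝ (Fin d → ℝ)) (k : Fin (d + 1)) :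
    Module.finrank ℝ (b.flag k) = (k : ℕ) := by
  classical
  have h : LinearIndepOn ℝ id (b '' {i : Fin d | i.castSucc < k}) :=
    (b.linearIndependent.linearIndepOn _).id_image
  rw [Module.Basis.flag, finrank_span_set_eq_card h, Set.toFinset_image,
    Finset.card_image_of_injective _ b.injective, Set.toFinset_card]
  have e : {i : Fin d | i.castSucc < k} ≃ Fin (k : ℕ) :=
    { toFun := fun i => ⟨i.1, i.2⟩
      invFun := fun j => ⟨⟨j, by omega⟩, by
        change (Fin.castSucc _ : Fin (d + 1)) < k
        exact Fin.lt_def.2 j.2⟩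
      left_inv := fun _ => rfl
      right_inv := fun _ => rfl }
  simpa using Fintype.card_congr e

/-- The standard flag, whose `k`-th term is spanned by the first `k` standard basis vectors. -/
def std (d : ℕ) : CompleteFlag d where
  space := (Pi.basisFun ℝ (Fin d)).flag
  mono := (Pi.basisFun ℝ (Fin d)).flag_mono
  finrank_space := finrank_basis_flag _

/-- The action of `GL_d(ℝ)` on complete flags: `(g • F)^k = g (F^k)`. -/
instance : MulAction (Matrix.GeneralLinearGroup (Fin d) ℝ) (CompleteFlag d) where
  smul g F :=
    { space := fun k => (F.space k).map (Matrix.mulVecLin (g : Matrix (Fin d) (Fin d) ℝ))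
      mono := fun _ _ h => Submodule.map_mono (F.mono h)
      finrank_space := fun k => by
        rw [← F.finrank_space k]
        exact (Submodule.equivMapOfInjective _
          (Matrix.mulVec_injective_of_isUnit g.isUnit) (F.space k)).finrank_eq.symm }
  one_smul F := by
    ext1; funext k
    change (F.space k).map (Matrix.mulVecLin 1) = _
    rw [Matrix.mulVecLin_one, Submodule.map_id]
  mul_smul g h F := by
    ext1; funext k
    change (F.space k).map (Matrix.mulVecLin (g.1 * h.1)) =
      ((F.space k).map (Matrix.mulVecLin h.1)).map (Matrix.mulVecLin g.1)
    rw [Matrix.mulVecLin_mul, Submodule.map_comp]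

theorem smul_space (g : Matrix.GeneralLinearGroup (Fin d) ℝ) (F : CompleteFlag d)
    (k : Fin (d + 1)) :
    (g • F).space k =
      (F.space k).map (Matrix.mulVecLin (g : Matrix (Fin d) (Fin d) ℝ)) := rfl

/-- Scalar matrices act trivially on flags. -/
theorem center_le_ker_toPermHom :
    Subgroup.center (Matrix.GeneralLinearGroup (Fin d) ℝ) ≤
      (MulAction.toPermHom (Matrix.GeneralLinearGroup (Fin d) ℝ) (CompleteFlag d)).ker := by
  rw [Matrix.GeneralLinearGroup.center_eq_range_scalar]
  rintro _ ⟨a, rfl⟩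
  rw [MonoidHom.mem_ker]
  ext1 F
  ext1
  funext k
  change (F.space k).map (Matrix.mulVecLin (Matrix.scalar (Fin d) (a : ℝ))) = F.space k
  have : Matrix.mulVecLin (Matrix.scalar (Fin d) (a : ℝ)) = (a : ℝ) • LinearMap.id := by
    ext1 v
    simp [Matrix.scalar_apply, ← Matrix.smul_one_eq_diagonal]
  rw [this, Submodule.map_smul _ _ _ a.ne_zero, Submodule.map_id]

/-- The action of `PGL_d(ℝ)` on complete flags, induced by that of `GL_d(ℝ)`. -/
instance : MulAction (Matrix.ProjGenLinGroup (Fin d) ℝ) (CompleteFlag d) :=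
  MulAction.compHom (CompleteFlag d)
    (QuotientGroup.lift (Subgroup.center (Matrix.GeneralLinearGroup (Fin d) ℝ))
      (MulAction.toPermHom (Matrix.GeneralLinearGroup (Fin d) ℝ) (CompleteFlag d))
      center_le_ker_toPermHom : Matrix.ProjGenLinGroup (Fin d) ℝ →* Equiv.Perm (CompleteFlag d))

theorem mk_smul (g : Matrix.GeneralLinearGroup (Fin d) ℝ) (F : CompleteFlag d) :
    Matrix.ProjGenLinGroup.mk g • F = g • F := rfl

/-- The topology of the flag manifold: the quotient topology of `GL_d(ℝ)` under the (transitive)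
action on the standard flag. -/
instance : TopologicalSpace (CompleteFlag d) :=
  TopologicalSpace.coinduced
    (fun g : Matrix.GeneralLinearGroup (Fin d) ℝ => g • std d) inferInstance

/-- `F` and `G` are transverse if `F^k + G^(d-k) = ℝ^d` for all `k`
(for `k = 0` and `k = d` this always holds). Here `k.rev` is `d - k`. -/
def Transverse (F G : CompleteFlag d) : Prop :=
  ∀ k : Fin (d + 1), F.space k ⊔ G.space k.rev = ⊤

end CompleteFlag

/-- An upper triangular unipotent matrix is totally positive if all its minors are positive, except
those that vanish because the matrix is upper triangular. The minor with rows `I 0 < I 1 < ⋯` and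
columns `J 0 < J 1 < ⋯` is not forced to vanish exactly when `I p ≤ J p` for all `p`. -/
structure IsTotallyPositiveUnipotent {d : ℕ} (A : Matrix (Fin d) (Fin d) ℝ) : Prop where
  upper : ∀ i j, j < i → A i j = 0
  diag : ∀ i, A i i = 1
  minor_pos : ∀ (k : ℕ) (I J : Fin k ↪o Fin d), (∀ p, I p ≤ J p) → 0 < (A.submatrix I J).det

/-- The set `U_{>0}(B) ⊆ PGL_d(ℝ)` of elements represented, in the basis `B`, by an upper
triangular unipotent totally positive matrix. -/
def totallyPositiveUnipotents {d : ℕ} (B : Module.Basis (Fin d) ℝ (Fin d → ℝ)) :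
    Set (Matrix.ProjGenLinGroup (Fin d) ℝ) :=
  {u | ∃ g : Matrix.GeneralLinearGroup (Fin d) ℝ, Matrix.ProjGenLinGroup.mk g = u ∧
    IsTotallyPositiveUnipotent
      (LinearMap.toMatrix B B (Matrix.mulVecLin (g : Matrix (Fin d) (Fin d) ℝ)))}

/-- Positivity of an `n`-tuple `(F_1, …, F_n)` of complete flags, with `n = m + 3 ≥ 3`.
The flag `F_j` is `F (j - 1)`, the basis vector `e_i` is `B (i - 1)`, and the elements
`u_2, …, u_{n-1}` are `u 0, …, u m`. Thus the second condition reads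
`e_i ∈ F_1^i ∩ F_n^(d-i+1)` for `1 ≤ i ≤ d`, and the last one reads
`F_j = (u_{n-1} ⋯ u_j) • F_n` for `2 ≤ j ≤ n - 1`. -/
def IsPositiveTuple {d m : ℕ} (F : Fin (m + 3) → CompleteFlag d) : Prop :=
  (F 0).Transverse (F (Fin.last (m + 2))) ∧
  ∃ (B : Module.Basis (Fin d) ℝ (Fin d → ℝ)) (u : Fin (m + 1) → Matrix.ProjGenLinGroup (Fin d) ℝ),
    (∀ i : Fin d, B i ∈ (F 0).space i.succ ⊓ (F (Fin.last (m + 2))).space i.castSucc.rev) ∧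
    (∀ j, u j ∈ totallyPositiveUnipotents B) ∧
    ∀ j : Fin (m + 1),
      F j.succ.castSucc = (((List.ofFn u).drop j).reverse).prod • F (Fin.last (m + 2))

/-- The points `a 0, …, a (n-1)` of the circle are pairwise distinct and occur in this clockwise
cyclic order: they have arguments that decrease strictly within less than a full turn. -/
def IsClockwiseOrdered {n : ℕ} (a : Fin n → Circle) : Prop :=
  ∃ θ : Fin n → ℝ, StrictAnti θ ∧ (∀ i j, θ i - θ j < 2 * Real.pi) ∧
    ∀ i, Circle.exp (θ i) = a i

/-- A map from the circle to the flag manifold is transverse if it sends distinct points to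
transverse flags. -/
def IsTransverseMap {d : ℕ} (ξ : Circle → CompleteFlag d) : Prop :=
  ∀ x y : Circle, x ≠ y → (ξ x).Transverse (ξ y)

/-- A map from the circle to the flag manifold is positive if, for every `n = m + 3 ≥ 3`, it sends
every cyclically ordered `n`-tuple of pairwise distinct points to a positive `n`-tuple. -/
def IsPositiveMap {d : ℕ} (ξ : Circle → CompleteFlag d) : Prop :=
  ∀ (m : ℕ) (a : Fin (m + 3) → Circle), IsClockwiseOrdered a →
    IsPositiveTuple (fun i => ξ (a i))

end

section

open Filter Topology

/-! Fix x and let f(s) be the flag of ξ at clockwise angle s from x. Flags transverse to ξ(x) form a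
cell parametrized by upper unipotent matrices, so f(s) = Pγ(s)·opp with γ continuous on (0, 2π). The
triple (ξ(x), f(s), f(t)), s < t, is positive once γ(t)⁻¹γ(s) is totally positive. Pairs s < t form
a convex, hence connected, set, on which this condition is open (finitely many strict inequalities)
and closed (`IsLowerTP.of_tendsto`): a limit of totally positive unipotent matrices stays totally
positive if its corner minors are nonzero, which is the transversality of f(s) and f(t). Hence one
positive triple based at x gives all of them (`exists_unipotent_family`), and telescoping the
quotients γ(sᵢ₊₁)⁻¹γ(sᵢ) gives longer tuples starting at x.

To move the base point, a positive triple is read backwards (`IsPositiveTuple.reverse`). This also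
reverses the circle, so it is done twice, through an auxiliary point.

The closedness is proved by Neville elimination: total positivity is equivalent to a positive first
column together with total positivity of a matrix one size smaller, and both pass to the limit. -/

/-! ### Neville elimination and totally positive lower unipotent matrices -/

/-- The minor of `A` with rows `I` and columns `J`. -/
def natMinor (A : ℕ → ℕ → ℝ) {k : ℕ} (I J : Fin k → ℕ) : ℝ :=
  (Matrix.of fun p q => A (I p) (J q)).det

/-- The leading `d × d` block of `A` is lower triangular with unit diagonal. -/
structure IsLowerUnipotent (d : ℕ) (A : ℕ → ℕ → ℝ) : Prop where
  lower : ∀ i j, i < j → j < d → A i j = 0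
  diag : ∀ i, i < d → A i i = 1

/-- The leading `d × d` block of `A` is a totally positive lower triangular unipotent matrix. -/
structure IsLowerTP (d : ℕ) (A : ℕ → ℕ → ℝ) : Prop extends IsLowerUnipotent d A where
  minor_pos : ∀ (k : ℕ) (I J : Fin k → ℕ), StrictMono I → StrictMono J → (∀ p, J p ≤ I p) →
    (∀ p, I p < d) → 0 < natMinor A I J

/-- One step of Neville elimination: consecutive rows are subtracted so as to clear the first
column, and the first row and column are removed. -/
noncomputable def nevilleStep (A : ℕ → ℕ → ℝ) (i j : ℕ) : ℝ :=
  A (i + 1) (j + 1) - A (i + 1) 0 / A i 0 * A i (j + 1)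

theorem natMinor_congr {A B : ℕ → ℕ → ℝ} {k : ℕ} {I J I' J' : Fin k → ℕ}
    (h : ∀ p q, A (I p) (J q) = B (I' p) (J' q)) : natMinor A I J = natMinor B I' J' := by
  unfold natMinor
  congr 1
  ext p q
  exact h p q

/-- Minors of a lower triangular matrix vanish unless the column indices are bounded by the row
indices. -/
theorem natMinor_eq_zero_of_lt {d : ℕ} {A : ℕ → ℕ → ℝ} (hA : ∀ i j, i < j → j < d → A i j = 0)
    {k : ℕ} {I J : Fin k → ℕ} (hI : Monotone I) (hJ : Monotone J) (hJd : ∀ p, J p < d)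
    {p : Fin k} (hp : I p < J p) : natMinor A I J = 0 := by
  unfold natMinor
  rw [Matrix.det_apply]
  refine Finset.sum_eq_zero fun σ _ => ?_
  -- A permutation cannot map the indices ≥ p into those > p, so every Leibniz term has a factor
  -- above the diagonal.
  have : ∃ q, p ≤ q ∧ σ q ≤ p := by
    by_contra! h
    have hsub : (Finset.Ici p).image σ ⊆ Finset.Ioi p := by
      intro x hx
      obtain ⟨q, hq, rfl⟩ := Finset.mem_image.1 hx
      exact Finset.mem_Ioi.2 (h q (Finset.mem_Ici.1 hq))
    have := Finset.card_le_card hsub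
    rw [Finset.card_image_of_injective _ σ.injective, Fin.card_Ici, Fin.card_Ioi] at this
    omega
  obtain ⟨q, hq1, hq2⟩ := this
  rw [Finset.prod_eq_zero (Finset.mem_univ q), smul_zero]
  exact hA _ _ ((hI hq2).trans_lt (hp.trans_le (hJ hq1))) (hJd q)

/-- As the rows are consecutive, each row's predecessor lies in the minor: the elimination preserves
the determinant and clears the first column below its top entry. -/
theorem natMinor_consecutive_eq (A : ℕ → ℕ → ℝ) (i k : ℕ) (hA : ∀ p, p < k → A (i + p) 0 ≠ 0) :
    natMinor A (fun p : Fin (k + 1) => i + p) (fun q => (q : ℕ)) =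
      A i 0 * natMinor (nevilleStep A) (fun p : Fin k => i + p) (fun q => (q : ℕ)) := by
  unfold natMinor
  let B : Matrix (Fin (k + 1)) (Fin (k + 1)) ℝ := Matrix.of fun p q => Fin.cases (A i q)
    (fun p' : Fin k => A (i + p' + 1) q - A (i + p' + 1) 0 / A (i + p') 0 * A (i + p') q) p
  rw [Matrix.det_eq_of_forall_row_eq_smul_add_pred (B := B)
    (fun p : Fin k => A (i + p + 1) 0 / A (i + p) 0) (fun j => by simp [B])
    (fun p j => by simp [B, add_assoc]), Matrix.det_succ_column_zero, Fin.sum_univ_succ,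
    Finset.sum_eq_zero]
  · simp only [Fin.val_zero, pow_zero, one_mul, add_zero]
    congr 1
  · intro p _
    have := hA p p.2
    simp [B, this]

theorem IsLowerUnipotent.nevilleStep {n : ℕ} {A : ℕ → ℕ → ℝ} (hA : IsLowerUnipotent (n + 1) A) :
    IsLowerUnipotent n (nevilleStep A) where
  lower i j hij hj := by
    simp [_root_.nevilleStep, hA.lower (i + 1) (j + 1) (by omega) (by omega),
      hA.lower i (j + 1) (by omega) (by omega)]
  diag i hi := by
    simp [_root_.nevilleStep, hA.diag (i + 1) (by omega), hA.lower i (i + 1) (by omega) (by omega)]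

/-- Adding a multiple of row `r` to row `r + 1` changes a minor that contains row `r + 1` by
a multiple of the minor in which that row is replaced by row `r`. -/
theorem natMinor_of_row_add {M M' : ℕ → ℕ → ℝ} {k r : ℕ} {c : ℝ} {I J : Fin k → ℕ}
    (hI : Function.Injective I)
    (h : ∀ i j, i ≠ r + 1 → M' i j = M i j) (h' : ∀ j, M' (r + 1) j = M (r + 1) j + c * M r j)
    {p : Fin k} (hp : I p = r + 1) :
    natMinor M' I J = natMinor M I J + c * natMinor M (Function.update I p r) J := by
  have e : (Matrix.of fun p q => M' (I p) (J q)) =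
      Matrix.updateRow (Matrix.of fun p q => M (I p) (J q)) p
        ((fun q => M (I p) (J q)) + c • fun q => M r (J q)) := by
    ext a q
    by_cases ha : a = p
    · subst ha; simp [hp, h']
    · rw [Matrix.updateRow_ne ha]
      exact h _ _ fun hh => ha (hI (hh.trans hp.symm))
  unfold natMinor
  rw [e, Matrix.det_updateRow_add, Matrix.det_updateRow_smul]
  congr 2
  · ext a q
    by_cases ha : a = p
    · subst ha; simp
    · simp [Matrix.updateRow_ne ha]
  · congr 1
    ext a q
    by_cases ha : a = p
    · subst ha; simp
    · simp [ha]

/-- Neville elimination carried out in the rows from `r + 1` on only. -/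
noncomputable def partialNeville (A : ℕ → ℕ → ℝ) (r i j : ℕ) : ℝ :=
  if i ≤ r then A i j else A i j - A i 0 / A (i - 1) 0 * A (i - 1) j

/-- On the leading block, full elimination leaves the block diagonal matrix with blocks 1 and
`nevilleStep A`. A minor using column 0 is therefore zero unless it also uses row 0. -/
theorem partialNeville_zero_minor {n : ℕ} {A : ℕ → ℕ → ℝ} (hA : IsLowerUnipotent (n + 1) A)
    (hpos : ∀ i, i < n + 1 → 0 < A i 0) (hN : IsLowerTP n (nevilleStep A)) 
    {k : ℕ} {I J : Fin k → ℕ} (hI : StrictMono I) (hJ : StrictMono J) (hJI : ∀ p, J p ≤ I p)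
    (hIn : ∀ p, I p < n + 1) :
    0 ≤ natMinor (partialNeville A 0) I J ∧
    ((∀ p, J p = 0 → I p = 0) → 0 < natMinor (partialNeville A 0) I J) := by
  have succ_case : ∀ {k : ℕ} {I J : Fin k → ℕ} (hI : StrictMono I) (hJ : StrictMono J)
      (hJI : ∀ p, J p ≤ I p) (hIn : ∀ p, I p < n + 1) (hJ0 : ∀ p, J p ≠ 0),
      0 < natMinor (partialNeville A 0) I J := by
    intro k I J hI hJ hJI hIn hJ0
    rw [natMinor_congr (B := nevilleStep A) (I' := fun p => I p - 1) (J' := fun p => J p - 1)]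
    · refine hN.minor_pos k _ _ (fun a b hab => ?_) (fun a b hab => ?_) (fun p => ?_) fun p => ?_
      · have := hI hab; have := hJI a; have := hJ0 a; omega
      · have := hJ hab; have := hJ0 a; omega
      · have := hJI p; omega
      · have := hIn p; have := hJ0 p; have := hJI p; omega
    · intro p q
      obtain ⟨a, ha⟩ : ∃ a, I p = a + 1 :=
        Nat.exists_eq_succ_of_ne_zero (by have := hJI p; have := hJ0 p; omega)
      obtain ⟨b, hb⟩ := Nat.exists_eq_succ_of_ne_zero (hJ0 q)
      simp [partialNeville, nevilleStep, ha, hb]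
  have col : ∀ i, i ≠ 0 → i < n + 1 → partialNeville A 0 i 0 = 0 := by
    intro i hi hin
    have := (hpos (i - 1) (by omega)).ne'
    simp [partialNeville, hi, this]
  cases k with
  | zero => simp [natMinor]
  | succ k =>
    by_cases hJ0 : J 0 = 0
    · by_cases hI0 : I 0 = 0
      · have : natMinor (partialNeville A 0) I J =
            natMinor (partialNeville A 0) (I ∘ Fin.succ) (J ∘ Fin.succ) := by
          unfold natMinor
          rw [Matrix.det_succ_column_zero, Fin.sum_univ_succ, Finset.sum_eq_zero]
          · have : partialNeville A 0 0 0 = 1 := by simp [partialNeville, hA.diag 0]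
            simp only [Fin.val_zero, pow_zero, one_mul, add_zero, Matrix.of_apply, hI0, hJ0, this]
            rfl
          · intro p _
            have : I p.succ ≠ 0 := by have := hI p.succ_pos; omega
            simp [hJ0, col _ this (hIn _)]
        have hpos' := succ_case (hI.comp Fin.strictMono_succ) (hJ.comp Fin.strictMono_succ)
          (fun p => hJI _) (fun p => hIn _)
          (fun p => by have := hJ p.succ_pos; simp only [Function.comp]; omega)
        rw [this]
        exact ⟨hpos'.le, fun _ => hpos'⟩
      · refine ⟨le_of_eq (Eq.symm ?_), fun h => absurd (h 0 hJ0) hI0⟩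
        unfold natMinor
        refine Matrix.det_eq_zero_of_column_eq_zero 0 fun p => ?_
        have : I p ≠ 0 := by have := hI.monotone p.zero_le; omega
        simp [hJ0, col _ this (hIn _)]
    · have := succ_case hI hJ hJI hIn fun p => by have := hJ.monotone p.zero_le; omega
      exact ⟨this.le, fun _ => this⟩

/-- The elimination is undone one row at a time, by adding a positive multiple of row r to row r +
1. Minors stay nonnegative; the condition on column 0 records which ones have already become
positive. -/
theorem partialNeville_minor {n : ℕ} {A : ℕ → ℕ → ℝ} (hA : IsLowerUnipotent (n + 1) A)
    (hpos : ∀ i, i < n + 1 → 0 < A i 0) (hN : IsLowerTP n (nevilleStep A)) (r : ℕ) :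
    ∀ {k : ℕ} {I J : Fin k → ℕ}, StrictMono I → StrictMono J → (∀ p, J p ≤ I p) →
      (∀ p, I p < n + 1) →
      0 ≤ natMinor (partialNeville A r) I J ∧
      ((∀ p, J p = 0 → I p ≤ r) → 0 < natMinor (partialNeville A r) I J) := by
  induction r with
  | zero =>
    intro k I J hI hJ hJI hIn
    simpa using partialNeville_zero_minor hA hpos hN hI hJ hJI hIn
  | succ r ih =>
    intro k I J hI hJ hJI hIn
    have ne : ∀ i j, i ≠ r + 1 → partialNeville A (r + 1) i j = partialNeville A r i j := by
      intro i j hi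
      have : i ≤ r + 1 ↔ i ≤ r := by omega
      simp [partialNeville, this]
    have eq : ∀ j, partialNeville A (r + 1) (r + 1) j =
        partialNeville A r (r + 1) j + A (r + 1) 0 / A r 0 * partialNeville A r r j := by
      intro j
      simp [partialNeville]
    by_cases hr : ∃ p, I p = r + 1
    · obtain ⟨p, hp⟩ := hr
      rw [natMinor_of_row_add hI.injective ne eq hp]
      have hc : 0 < A (r + 1) 0 / A r 0 := by
        have := hIn p
        exact div_pos (hpos _ (by omega)) (hpos _ (by omega))
      have h1 := ih hI hJ hJI hIn
      -- The minor with row r + 1 replaced by row r is positive exactly where positivity of the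
      -- first summand is not yet known. It vanishes if row r is already present or if `J p` exceeds
      -- r, but then column 0 can only be paired with a row at most r.
      have h2 : 0 ≤ natMinor (partialNeville A r) (Function.update I p r) J ∧
          ((∀ p, J p = 0 → I p ≤ r + 1) → ¬ (∀ p, J p = 0 → I p ≤ r) →
            0 < natMinor (partialNeville A r) (Function.update I p r) J) := by
        by_cases hq : ∃ q, I q = r
        · obtain ⟨q, hq⟩ := hq
          have hqp : q < p := hI.lt_iff_lt.1 (by omega)
          have h0 : natMinor (partialNeville A r) (Function.update I p r) J = 0 := by
            unfold natMinor
            refine Matrix.det_zero_of_row_eq hqp.ne ?_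
            ext a
            simp [hqp.ne, hq]
          refine ⟨h0.ge, fun _ h4 => absurd (fun a ha => ?_) h4⟩
          have : a ≤ q := by
            by_contra! h; have := hJ h; omega
          exact hq ▸ hI.monotone this
        · have hmono : StrictMono (Function.update I p r) := by
            intro a b hab
            have hab' := hI hab
            by_cases ha : a = p
            · subst ha
              rw [Function.update_self, Function.update_of_ne hab.ne']; omega
            · rw [Function.update_of_ne ha]
              by_cases hb : b = p
              · subst hb
                rw [Function.update_self]
                have : I a ≠ r := fun h => hq ⟨a, h⟩
                omega
              · rwa [Function.update_of_ne hb]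
          have hlt : ∀ a, Function.update I p r a < n + 1 := by
            intro a
            by_cases ha : a = p
            · subst ha; have := hIn a; simp; omega
            · simp [ha, hIn]
          by_cases hJp : J p ≤ r
          · have hle : ∀ a, J a ≤ Function.update I p r a := by
              intro a
              by_cases ha : a = p
              · subst ha; simpa using hJp
              · simp [ha, hJI]
            refine ⟨(ih hmono hJ hle hlt).1, fun h3 _ => (ih hmono hJ hle hlt).2 fun a ha => ?_⟩
            by_cases hap : a = p
            · subst hap; simp
            · rw [Function.update_of_ne hap]
              have := h3 a ha
              have : I a ≠ r + 1 := fun h => hap (hI.injective (h.trans hp.symm))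
              omega
          · have hlow : ∀ i j, i < j → j < n + 1 → partialNeville A r i j = 0 := by
              intro i j hij hj
              simp [partialNeville, hA.lower i j hij hj, hA.lower (i - 1) j (by omega) hj]
            have h0 : natMinor (partialNeville A r) (Function.update I p r) J = 0 :=
              natMinor_eq_zero_of_lt hlow hmono.monotone hJ.monotone
                (fun a => (hJI a).trans_lt (hIn a)) (p := p) (by simp; omega)
            refine ⟨h0.ge, fun h3 h4 => absurd (fun a ha => ?_) h4⟩
            have : a < p := hJ.lt_iff_lt.1 (by omega)
            have := hI this
            omega
      refine ⟨add_nonneg h1.1 (mul_nonneg hc.le h2.1), fun h3 => ?_⟩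
      by_cases h4 : ∀ p, J p = 0 → I p ≤ r
      · exact add_pos_of_pos_of_nonneg (h1.2 h4) (mul_nonneg hc.le h2.1)
      · exact add_pos_of_nonneg_of_pos h1.1 (mul_pos hc (h2.2 h3 h4))
    · push Not at hr
      rw [natMinor_congr (B := partialNeville A r) (I' := I) (J' := J) fun p q => ne _ _ (hr p)]
      refine ⟨(ih hI hJ hJI hIn).1, fun h => (ih hI hJ hJI hIn).2 fun p hp => ?_⟩
      have := h p hp
      have := hr p
      omega

/-- After all n rows are restored, `partialNeville A n` agrees with `A` on the leading block. -/
theorem IsLowerTP.of_nevilleStep {n : ℕ} {A : ℕ → ℕ → ℝ} (hA : IsLowerUnipotent (n + 1) A)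
    (hpos : ∀ i, i < n + 1 → 0 < A i 0) (hN : IsLowerTP n (nevilleStep A)) :
    IsLowerTP (n + 1) A where
  toIsLowerUnipotent := hA
  minor_pos k I J hI hJ hJI hIn := by
    have := (partialNeville_minor hA hpos hN n hI hJ hJI hIn).2
      fun p _ => Nat.lt_succ_iff.1 (hIn p)
    rwa [natMinor_congr (B := A) (I' := I) (J' := J)] at this
    intro p q
    simp [partialNeville, Nat.lt_succ_iff.1 (hIn p)]

/-- A Fekete type criterion: the minors in consecutive rows and the initial columns suffice. -/
theorem IsLowerTP.of_consecutive {d : ℕ} {A : ℕ → ℕ → ℝ} (hA : IsLowerUnipotent d A)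
    (h : ∀ i k, i + k ≤ d → 0 < natMinor A (fun p : Fin k => i + p) (fun q => (q : ℕ))) :
    IsLowerTP d A := by
  induction d generalizing A with
  | zero =>
    refine ⟨hA, fun k I J _ _ _ hI => ?_⟩
    cases k with
    | zero => simp [natMinor]
    | succ k => exact absurd (hI 0) (by omega)
  | succ n ih =>
    have hpos : ∀ i, i < n + 1 → 0 < A i 0 := fun i hi => by
      simpa [natMinor] using h i 1 (by omega)
    refine .of_nevilleStep hA hpos (ih hA.nevilleStep fun i k hik => ?_)
    have := h i (k + 1) (by omega)
    rw [natMinor_consecutive_eq A i k fun p hp => (hpos _ (by omega)).ne'] at this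
    exact (mul_pos_iff_of_pos_left (hpos _ (by omega))).1 this

theorem IsLowerTP.consecutive {d : ℕ} {A : ℕ → ℕ → ℝ} (hA : IsLowerTP d A) (i k : ℕ)
    (hik : i + k ≤ d) : 0 < natMinor A (fun p : Fin k => i + p) (fun q => (q : ℕ)) :=
  hA.minor_pos _ _ _ (fun a b hab => by simpa using hab) (fun a b hab => by simpa using hab)
    (fun p => by simp) fun p => by have := p.2; omega

theorem IsLowerTP.col_pos {n : ℕ} {A : ℕ → ℕ → ℝ} (hA : IsLowerTP (n + 1) A) (i : ℕ)
    (hi : i < n + 1) : 0 < A i 0 := by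
  simpa [natMinor] using hA.consecutive i 1 (by omega)

/-- Only the consecutive initial minors of the step are directly quotients of minors of `A`; the
Fekete criterion supplies the others. -/
theorem IsLowerTP.nevilleStep {n : ℕ} {A : ℕ → ℕ → ℝ} (hA : IsLowerTP (n + 1) A) :
    IsLowerTP n (nevilleStep A) := by
  refine .of_consecutive hA.toIsLowerUnipotent.nevilleStep fun i k hik => ?_
  have := hA.consecutive i (k + 1) (by omega)
  rw [natMinor_consecutive_eq A i k fun p hp => (hA.col_pos _ (by omega)).ne'] at this
  exact (mul_pos_iff_of_pos_left (hA.col_pos _ (by omega))).1 this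

/-- A limit of totally positive unipotent matrices is totally positive as soon as its corner minors
do not vanish. -/
theorem IsLowerTP.of_tendsto {α : Type*} {l : Filter α} [l.NeBot] {d : ℕ} {A : ℕ → ℕ → ℝ}
    {a : α → ℕ → ℕ → ℝ} (ha : ∀ᶠ x in l, IsLowerTP d (a x))
    (hlim : ∀ i j, i < d → j < d → Tendsto (fun x => a x i j) l (𝓝 (A i j)))
    (hA : ∀ k, k ≤ d → natMinor A (fun p : Fin k => d - k + p) (fun q => (q : ℕ)) ≠ 0) :
    IsLowerTP d A := by
  induction d generalizing A a with
  | zero =>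
    obtain ⟨x, hx⟩ := ha.exists
    refine .of_consecutive ⟨fun _ _ _ h => absurd h (by omega), fun _ h => absurd h (by omega)⟩ ?_
    intro i k hik
    obtain rfl : k = 0 := by omega
    simp [natMinor]
  | succ n ih =>
    have hU : IsLowerUnipotent (n + 1) A := by
      constructor
      · intro i j hij hj
        exact tendsto_nhds_unique (hlim i j (by omega) hj)
          (tendsto_const_nhds.congr' (ha.mono fun x hx => (hx.lower i j hij hj).symm))
      · intro i hi
        exact tendsto_nhds_unique (hlim i i hi hi)
          (tendsto_const_nhds.congr' (ha.mono fun x hx => (hx.diag i hi).symm))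
    have hnn : ∀ i, i < n + 1 → 0 ≤ A i 0 := fun i hi =>
      ge_of_tendsto (hlim i 0 hi (by omega)) (ha.mono fun x hx => (hx.col_pos i hi).le)
    have hlast : 0 < A n 0 :=
      (hnn n (by omega)).lt_of_ne' (by simpa [natMinor] using hA 1 (by omega))
    have hpos : ∀ i, i < n + 1 → 0 < A i 0 := by
      intro i hi
      refine (hnn i hi).lt_of_ne' fun h0 => ?_
      rcases Nat.eq_zero_or_pos i with rfl | hi0
      · rw [hU.diag 0 hi] at h0; exact one_ne_zero h0
      rcases Nat.lt_succ_iff_lt_or_eq.1 hi with hin | rfl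
      -- The minor with rows i, n and columns 0, i stays nonnegative in the limit. If `A i 0 = 0`
      -- this reads `-A n 0 ≥ 0`, against the nonvanishing 1 × 1 corner.
      · have h1 : ∀ᶠ x in l, 0 ≤ a x i 0 * a x n i - a x i i * a x n 0 := by
          refine ha.mono fun x hx => ?_
          have := hx.minor_pos 2 ![i, n] ![0, i] (by simpa using hin) (by simpa using hi0)
            (fun p => by fin_cases p <;> simp; omega) (fun p => by fin_cases p <;> simp; omega)
          simpa [natMinor, Matrix.det_fin_two] using this.le
        have h2 := ge_of_tendsto (((hlim i 0 hi (by omega)).mul (hlim n i (by omega) hi)).sub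
          ((hlim i i hi hi).mul (hlim n 0 (by omega) (by omega)))) h1
        rw [h0, hU.diag i hi] at h2
        linarith
      · exact hlast.ne' h0
    -- With a positive first column the step is continuous at the limit, and its corner minors are
    -- those of `A` divided by a nonzero entry.
    refine .of_nevilleStep hU hpos (ih (a := fun x => _root_.nevilleStep (a x))
      (ha.mono fun x hx => hx.nevilleStep) (fun i j hi hj => ?_) fun k hk h0 => ?_)
    · exact (hlim _ _ (by omega) (by omega)).sub
        (((hlim _ _ (by omega) (by omega)).div (hlim _ _ (by omega) (by omega))
          (hpos i (by omega)).ne').mul (hlim _ _ (by omega) (by omega)))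
    · refine hA (k + 1) (by omega) ?_
      have : n + 1 - (k + 1) = n - k := by omega
      rw [this, natMinor_consecutive_eq A _ k fun p hp => (hpos _ (by omega)).ne', h0, mul_zero]

/-! ### Upper unipotent matrices and reversal of indices -/

/-- Upper triangular matrices with unit diagonal. -/
structure IsUpperUnipotent {d : ℕ} (A : Matrix (Fin d) (Fin d) ℝ) : Prop where
  upper : ∀ i j, j < i → A i j = 0
  diag : ∀ i, A i i = 1

theorem IsTotallyPositiveUnipotent.isUpperUnipotent {d : ℕ} {A : Matrix (Fin d) (Fin d) ℝ}
    (hA : IsTotallyPositiveUnipotent A) : IsUpperUnipotent A :=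
  ⟨hA.upper, hA.diag⟩

namespace IsUpperUnipotent

variable {d : ℕ} {A B : Matrix (Fin d) (Fin d) ℝ}

theorem one : IsUpperUnipotent (1 : Matrix (Fin d) (Fin d) ℝ) :=
  ⟨fun _ _ h => Matrix.one_apply_ne h.ne', fun _ => Matrix.one_apply_eq _⟩

theorem det (hA : IsUpperUnipotent A) : A.det = 1 := by
  rw [Matrix.det_of_isUpperTriangular fun i j h => hA.upper i j h]
  simp [hA.diag]

theorem mul_apply_diag (hA : ∀ i j, j < i → A i j = 0) (hB : ∀ i j, j < i → B i j = 0) (i : Fin d) :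
    (A * B) i i = A i i * B i i := by
  rw [Matrix.mul_apply, Finset.sum_eq_single i]
  · intro j _ hj
    rcases lt_or_gt_of_ne hj with h | h
    · simp [hA _ _ h]
    · simp [hB _ _ h]
  · simp

theorem mul (hA : IsUpperUnipotent A) (hB : IsUpperUnipotent B) : IsUpperUnipotent (A * B) where
  upper := Matrix.BlockTriangular.mul (b := id) (fun i j h => hA.upper i j h)
    fun i j h => hB.upper i j h
  diag i := by rw [mul_apply_diag hA.upper hB.upper, hA.diag, hB.diag, one_mul]

theorem inv {g : Matrix.GeneralLinearGroup (Fin d) ℝ} (hg : IsUpperUnipotent g.1) :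
    IsUpperUnipotent (g⁻¹).1 := by
  have hu : ∀ i j, j < i → (g⁻¹).1 i j = 0 := by
    have := g.invertible
    have := Matrix.blockTriangular_inv_of_blockTriangular (M := g.1) (b := id)
      fun i j h => hg.upper i j h
    intro i j h
    rw [Matrix.coe_units_inv]
    exact this h
  refine ⟨hu, fun i => ?_⟩
  have := mul_apply_diag hu hg.upper i
  rw [g.inv_mul, Matrix.one_apply_eq, hg.diag, mul_one] at this
  exact this.symm

/-- An upper unipotent matrix as an element of the general linear group. -/
noncomputable def toGL (hA : IsUpperUnipotent A) : Matrix.GeneralLinearGroup (Fin d) ℝ :=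
  Matrix.GeneralLinearGroup.mkOfDetNeZero A (by simp [hA.det])

@[simp]
theorem coe_toGL (hA : IsUpperUnipotent A) : (hA.toGL : Matrix (Fin d) (Fin d) ℝ) = A := rfl

end IsUpperUnipotent

/-- The matrix `A` with both index sets reversed, extended by zero to natural indices. -/
noncomputable def revExtend {d : ℕ} (A : Matrix (Fin d) (Fin d) ℝ) (i j : ℕ) : ℝ :=
  if h : i < d ∧ j < d then A (Fin.rev ⟨i, h.1⟩) (Fin.rev ⟨j, h.2⟩) else 0

theorem revExtend_of_lt {d : ℕ} (A : Matrix (Fin d) (Fin d) ℝ) {i j : ℕ} (hi : i < d)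
    (hj : j < d) : revExtend A i j = A (Fin.rev ⟨i, hi⟩) (Fin.rev ⟨j, hj⟩) :=
  dif_pos ⟨hi, hj⟩

theorem natMinor_revExtend {d : ℕ} (A : Matrix (Fin d) (Fin d) ℝ) {k : ℕ} {I J : Fin k → ℕ}
    (hI : ∀ p, I p < d) (hJ : ∀ p, J p < d) :
    natMinor (revExtend A) I J =
      (A.submatrix (fun p => Fin.rev ⟨I p, hI p⟩) fun p => Fin.rev ⟨J p, hJ p⟩).det := by
  unfold natMinor
  congr 1
  ext p q
  simp [revExtend_of_lt A (hI p) (hJ q)]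

theorem IsUpperUnipotent.isLowerUnipotent {d : ℕ} {A : Matrix (Fin d) (Fin d) ℝ}
    (hA : IsUpperUnipotent A) : IsLowerUnipotent d (revExtend A) where
  lower i j hij hj := by
    rw [revExtend_of_lt A (hij.trans hj) hj]
    exact hA.upper _ _ (Fin.rev_lt_rev.2 hij)
  diag i hi := by rw [revExtend_of_lt A hi hi, hA.diag]

theorem IsTotallyPositiveUnipotent.isLowerTP {d : ℕ} {A : Matrix (Fin d) (Fin d) ℝ}
    (hA : IsTotallyPositiveUnipotent A) : IsLowerTP d (revExtend A) where
  toIsLowerUnipotent := hA.isUpperUnipotent.isLowerUnipotent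
  minor_pos k I J hI hJ hJI hId := by
    have hJd : ∀ p, J p < d := fun p => (hJI p).trans_lt (hId p)
    -- Reversing rows and columns simultaneously preserves the determinant and makes the index lists
    -- increasing again.
    rw [natMinor_revExtend A hId hJd, ← Matrix.det_submatrix_equiv_self Fin.revPerm]
    refine hA.minor_pos k
      (OrderEmbedding.ofStrictMono (fun p => Fin.rev ⟨I p.rev, hId _⟩) fun a b h =>
        Fin.rev_lt_rev.2 (hI (Fin.rev_lt_rev.2 h)))
      (OrderEmbedding.ofStrictMono (fun p => Fin.rev ⟨J p.rev, hJd _⟩) fun a b h =>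
        Fin.rev_lt_rev.2 (hJ (Fin.rev_lt_rev.2 h))) fun p => ?_
    exact Fin.rev_le_rev.2 (hJI _)

theorem IsLowerTP.isTotallyPositiveUnipotent {d : ℕ} {A : Matrix (Fin d) (Fin d) ℝ}
    (hU : IsUpperUnipotent A) (hA : IsLowerTP d (revExtend A)) : IsTotallyPositiveUnipotent A where
  upper := hU.upper
  diag := hU.diag
  minor_pos k I J hIJ := by
    have := hA.minor_pos k (fun p => (I p.rev).rev) (fun p => (J p.rev).rev)
      (fun a b h => Fin.rev_lt_rev.2 (I.strictMono (Fin.rev_lt_rev.2 h)))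
      (fun a b h => Fin.rev_lt_rev.2 (J.strictMono (Fin.rev_lt_rev.2 h)))
      (fun p => Fin.rev_le_rev.2 (hIJ _)) fun p => Fin.is_lt _
    rw [natMinor_revExtend A (fun p => Fin.is_lt _) (fun p => Fin.is_lt _),
      ← Matrix.det_submatrix_equiv_self Fin.revPerm] at this
    convert this using 2
    ext p q
    simp only [Matrix.submatrix_apply, Fin.revPerm_apply, Fin.rev_rev, Fin.eta]

/-- A submatrix with suitably solvable linear systems is invertible. -/
theorem isUnit_submatrix_of_solvable {d : ℕ} (g : Matrix (Fin d) (Fin d) ℝ) {ι : Type*} [Fintype ι]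
    [DecidableEq ι] (R C : ι → Fin d) (hC : Function.Injective C)
    (h : ∀ w : Fin d → ℝ, ∃ b : Fin d → ℝ, (∀ j, j ∉ Set.range C → b j = 0) ∧
      ∀ p, (g.mulVec b) (R p) = w (R p)) (hR : Function.Injective R) :
    IsUnit (g.submatrix R C) := by
  rw [← Matrix.mulVec_surjective_iff_isUnit]
  intro w
  obtain ⟨b, hb, hbw⟩ := h (Function.extend R w 0)
  refine ⟨b ∘ C, ?_⟩
  ext p
  have := hbw p
  rw [hR.extend_apply] at this
  rw [← this]
  simp only [Matrix.mulVec, dotProduct]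
  exact Fintype.sum_of_injective C hC _ _ (fun j hj => by simp [hb j hj]) fun q => by simp

/-! ### The cell of flags transverse to the standard flag -/

namespace CompleteFlag

variable {d : ℕ}

theorem eq_of_le {F G : CompleteFlag d} (h : ∀ k, F.space k ≤ G.space k) : F = G := by
  ext1
  funext k
  exact Submodule.eq_of_le_of_finrank_eq (h k) (by rw [F.finrank_space, G.finrank_space])

theorem mem_std {k : Fin (d + 1)} {v : Fin d → ℝ} :
    v ∈ (std d).space k ↔ ∀ i : Fin d, (k : ℕ) ≤ i → v i = 0 := by
  change v ∈ Submodule.span ℝ _ ↔ _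
  rw [Module.Basis.mem_span_image]
  simp only [Set.subset_def, Finset.mem_coe, Finsupp.mem_support_iff, Pi.basisFun_repr,
    Set.mem_ofPred_eq, Fin.lt_def, Fin.val_castSucc]
  refine forall_congr' fun i => ?_
  rw [← not_imp_not, not_lt, not_not]

theorem revPerm_mul_self : (Fin.revPerm : Equiv.Perm (Fin d)) * Fin.revPerm = 1 := by
  ext
  simp

/-- The permutation matrix of the longest permutation. -/
def longest (d : ℕ) : Matrix.GeneralLinearGroup (Fin d) ℝ where
  val := Fin.revPerm.permMatrix ℝ
  inv := Fin.revPerm.permMatrix ℝ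
  val_inv := by rw [← Matrix.permMatrix_mul, revPerm_mul_self]; simp
  inv_val := by rw [← Matrix.permMatrix_mul, revPerm_mul_self]; simp

theorem longest_mulVec (v : Fin d → ℝ) (i : Fin d) : (longest d).1.mulVec v i = v i.rev := by
  simp [longest, Matrix.permMatrix_mulVec]

/-- The standard opposite flag, whose `k`-th term is spanned by the last `k` basis vectors. -/
noncomputable def opp (d : ℕ) : CompleteFlag d := longest d • std d

theorem mem_smul {g : Matrix.GeneralLinearGroup (Fin d) ℝ} {F : CompleteFlag d} {k : Fin (d + 1)}
    {v : Fin d → ℝ} : v ∈ (g • F).space k ↔ ∃ w ∈ F.space k, g.1.mulVec w = v :=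
  Iff.rfl

theorem mem_opp {k : Fin (d + 1)} {v : Fin d → ℝ} :
    v ∈ (opp d).space k ↔ ∀ i : Fin d, (i : ℕ) + k < d → v i = 0 := by
  unfold opp
  rw [mem_smul]
  constructor
  · rintro ⟨w, hw, rfl⟩ i hi
    rw [longest_mulVec]
    exact mem_std.1 hw _ (by rw [Fin.val_rev]; omega)
  · intro h
    refine ⟨fun i => v i.rev, mem_std.2 fun i hi => h _ (by rw [Fin.val_rev]; omega), ?_⟩
    ext i
    simp [longest_mulVec]

theorem smul_std_of_upper {g : Matrix.GeneralLinearGroup (Fin d) ℝ}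
    (hg : ∀ i j, j < i → g.1 i j = 0) : g • std d = std d := by
  refine eq_of_le fun k => ?_
  rintro v ⟨w, hw, rfl⟩
  refine mem_std.2 fun i hi => ?_
  simp only [Matrix.mulVecLin_apply, Matrix.mulVec, dotProduct]
  refine Finset.sum_eq_zero fun j _ => ?_
  rcases lt_or_ge j i with h | h
  · simp [hg _ _ h]
  · rw [mem_std.1 hw j (hi.trans h), mul_zero]

theorem smul_opp_of_lower {g : Matrix.GeneralLinearGroup (Fin d) ℝ}
    (hg : ∀ i j, i < j → g.1 i j = 0) : g • opp d = opp d := by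
  refine eq_of_le fun k => ?_
  rintro v ⟨w, hw, rfl⟩
  refine mem_opp.2 fun i hi => ?_
  simp only [Matrix.mulVecLin_apply, Matrix.mulVec, dotProduct]
  refine Finset.sum_eq_zero fun j _ => ?_
  rcases lt_or_ge i j with h | h
  · simp [hg _ _ h]
  · rw [mem_opp.1 hw j (by rw [Fin.le_def] at h; omega), mul_zero]

theorem Transverse.smul {F G : CompleteFlag d} (h : F.Transverse G)
    (g : Matrix.GeneralLinearGroup (Fin d) ℝ) : (g • F).Transverse (g • G) := by
  intro k
  rw [smul_space, smul_space, ← Submodule.map_sup, h k, Submodule.map_top, LinearMap.range_eq_top]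
  exact Matrix.mulVec_surjective_iff_isUnit.2 g.isUnit

theorem Transverse.symm {F G : CompleteFlag d} (h : F.Transverse G) : G.Transverse F := by
  intro k
  have := h k.rev
  rwa [Fin.rev_rev, sup_comm] at this

theorem transverse_std_opp : (std d).Transverse (opp d) := by
  refine fun k => eq_top_iff.2 fun v _ => Submodule.mem_sup.2
    ⟨fun i => if (i : ℕ) < k then v i else 0, mem_std.2 fun i hi => if_neg (by omega),
      fun i => if (i : ℕ) < k then 0 else v i, mem_opp.2 fun i hi => if_pos ?_, ?_⟩
  · rw [Fin.val_rev] at hi; omega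
  · ext i
    by_cases h : (i : ℕ) < k <;> simp [h]

/-- Flags transverse to the standard flag are images of the opposite flag under upper unipotent
matrices. -/
theorem Transverse.exists_unipotent {G : CompleteFlag d} (h : (std d).Transverse G) :
    ∃ u : Matrix.GeneralLinearGroup (Fin d) ℝ, IsUpperUnipotent u.1 ∧ G = u • opp d := by
  -- Split the j-th basis vector along the two flags: its component in G is the j-th column of the
  -- unipotent matrix.
  have : ∀ j : Fin d, ∃ w ∈ G.space j.castSucc.rev, w j = 1 ∧ ∀ i, j < i → w i = 0 := by
    intro j
    obtain ⟨a, ha, b, hb, hab⟩ := Submodule.mem_sup.1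
      ((h j.castSucc).ge (Submodule.mem_top : (Pi.single j 1 : Fin d → ℝ) ∈ ⊤))
    have hab' := congrFun hab
    refine ⟨b, hb, ?_, fun i hi => ?_⟩
    · have := hab' j
      simpa [mem_std.1 ha j (by simp)] using this
    · have := hab' i
      simpa [mem_std.1 ha i (by simpa using hi.le), hi.ne'] using this
  choose w hw hw1 hw0 using this
  have hU : IsUpperUnipotent (Matrix.of fun i j => w j i) := ⟨fun i j h => hw0 j i h, hw1⟩
  refine ⟨hU.toGL, hU, (eq_of_le fun k => ?_).symm⟩
  rintro v ⟨b, hb, rfl⟩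
  have : Matrix.mulVecLin (hU.toGL : Matrix (Fin d) (Fin d) ℝ) b = ∑ j, b j • w j := by
    ext i
    simp [Matrix.mulVec, dotProduct, mul_comm]
  rw [this]
  refine Submodule.sum_mem _ fun j _ => ?_
  by_cases hj : (j : ℕ) + k < d
  · rw [mem_opp.1 hb j hj, zero_smul]
    exact Submodule.zero_mem _
  · refine Submodule.smul_mem _ _ (G.mono ?_ (hw j))
    rw [Fin.le_def, Fin.val_rev, Fin.val_castSucc]
    omega

theorem lower_of_smul_opp {g : Matrix.GeneralLinearGroup (Fin d) ℝ} (hs : g • opp d = opp d)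
    (i j : Fin d) (hij : i < j) : g.1 i j = 0 := by
  have : g.1.mulVec (Pi.single j 1) ∈ (opp d).space j.castSucc.rev := by
    rw [← hs]
    refine mem_smul.2 ⟨_, mem_opp.2 fun i hi => Pi.single_eq_of_ne ?_ _, rfl⟩
    rintro rfl
    rw [Fin.val_rev, Fin.val_castSucc] at hi
    omega
  have := mem_opp.1 this i (by
    rw [Fin.val_rev, Fin.val_castSucc]; rw [Fin.lt_def] at hij; omega)
  rwa [Matrix.mulVec_single_one] at this

/-- The stabilizer of the opposite flag is lower triangular, and meets the upper unipotent matrices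
only in 1. -/
theorem smul_opp_injOn {g h : Matrix.GeneralLinearGroup (Fin d) ℝ} (hg : IsUpperUnipotent g.1)
    (hh : IsUpperUnipotent h.1) (e : g • opp d = h • opp d) : g = h := by
  have hu := hh.inv.mul hg
  have hs : (h⁻¹ * g) • opp d = opp d := by rw [mul_smul, e, inv_smul_smul]
  suffices h⁻¹ * g = 1 from (inv_mul_eq_one.1 this).symm
  refine Units.ext ?_
  ext i j
  rcases lt_trichotomy i j with hij | rfl | hij
  · simpa [Matrix.one_apply_ne hij.ne] using lower_of_smul_opp hs i j hij
  · simpa using hu.diag i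
  · simpa [Matrix.one_apply_ne hij.ne'] using hu.upper i j hij

/-- The corner minors of an upper unipotent matrix moving the opposite flag to a transverse flag
do not vanish. -/
theorem Transverse.corner_ne_zero {g : Matrix.GeneralLinearGroup (Fin d) ℝ}
    (h : (g • opp d).Transverse (opp d)) {k : ℕ} (hk : k ≤ d) :
    natMinor (revExtend g.1) (fun p : Fin k => d - k + p) (fun q => (q : ℕ)) ≠ 0 := by
  rw [natMinor_revExtend g.1 (fun p => by omega) (fun p => by omega)]
  refine IsUnit.ne_zero ((Matrix.isUnit_iff_isUnit_det _).1
    (isUnit_submatrix_of_solvable _ _ _ ?_ ?_ ?_))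
  · intro a b hab
    simp only [Fin.ext_iff, Fin.val_rev] at hab
    ext
    omega
  -- Write w = gc + b: c is supported on the last k coordinates and b vanishes on the first k, which
  -- are the rows of the minor.
  · intro w
    obtain ⟨a, ⟨c, hc, hca⟩, b, hb, hab⟩ := Submodule.mem_sup.1
      ((h ⟨k, by omega⟩).ge (Submodule.mem_top : w ∈ ⊤))
    refine ⟨c, fun j hj => mem_opp.1 hc j ?_, fun p => ?_⟩
    · by_contra! hlt
      refine hj ⟨⟨d - 1 - j, by dsimp only at hlt; omega⟩, ?_⟩
      ext
      simp only [Fin.val_rev]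
      omega
    · have : b (Fin.rev ⟨d - k + p, by omega⟩) = 0 := mem_opp.1 hb _ (by
        simp only [Fin.val_rev]; omega)
      rw [← hab, Pi.add_apply, this, add_zero, ← hca]
      rfl
  · intro a b hab
    simp only [Fin.ext_iff, Fin.val_rev] at hab
    ext
    omega

/-- The lower right block of `g` with indices at least `j`. -/
def lowerBlock (g : Matrix (Fin d) (Fin d) ℝ) (j : Fin d) :
    Matrix {q : Fin d // j ≤ q} {q : Fin d // j ≤ q} ℝ :=
  g.submatrix Subtype.val Subtype.val

/-- The upper unipotent factor of `g` in the factorization into an upper unipotent and a lower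
triangular matrix. -/
noncomputable def upperFactor (g : Matrix (Fin d) (Fin d) ℝ) : Matrix (Fin d) (Fin d) ℝ :=
  fun i j => ∑ q : {q : Fin d // j ≤ q}, g i q * (lowerBlock g j)⁻¹ q ⟨j, le_rfl⟩

theorem Transverse.det_lowerBlock_ne_zero {g : Matrix.GeneralLinearGroup (Fin d) ℝ}
    (h : (std d).Transverse (g • opp d)) (j : Fin d) : (lowerBlock g.1 j).det ≠ 0 := by
  refine IsUnit.ne_zero ((Matrix.isUnit_iff_isUnit_det _).1
    (isUnit_submatrix_of_solvable _ _ _ Subtype.val_injective ?_ Subtype.val_injective))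
  intro w
  obtain ⟨a, ha, b, ⟨c, hc, hcb⟩, hab⟩ := Submodule.mem_sup.1
    ((h j.castSucc).ge (Submodule.mem_top : w ∈ ⊤))
  refine ⟨c, fun i hi => mem_opp.1 hc i ?_, fun p => ?_⟩
  · have : ¬ j ≤ i := fun hji => hi ⟨⟨i, hji⟩, rfl⟩
    rw [Fin.le_def] at this
    rw [Fin.val_rev, Fin.val_castSucc]
    omega
  · rw [← hab, Pi.add_apply, mem_std.1 ha p.1 (Fin.le_def.1 p.2), zero_add, ← hcb]
    rfl

/-- In rows i ≥ j, column j of the factor is a column of the lower block times its inverse. -/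
theorem isUpperUnipotent_upperFactor {g : Matrix (Fin d) (Fin d) ℝ}
    (h : ∀ j, (lowerBlock g j).det ≠ 0) : IsUpperUnipotent (upperFactor g) := by
  have key : ∀ i j (hij : j ≤ i), upperFactor g i j =
      (1 : Matrix {q : Fin d // j ≤ q} {q : Fin d // j ≤ q} ℝ) ⟨i, hij⟩ ⟨j, le_rfl⟩ := by
    intro i j hij
    rw [← Matrix.mul_nonsing_inv (lowerBlock g j) (h j).isUnit]
    rfl
  refine ⟨fun i j hij => ?_, fun i => ?_⟩
  · rw [key i j hij.le, Matrix.one_apply_ne]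
    simpa using hij.ne'
  · rw [key i i le_rfl, Matrix.one_apply_eq]

/-- The coefficients defining `upperFactor g` form a lower triangular matrix, which fixes the
opposite flag. -/
theorem smul_opp_eq_upperFactor {g : Matrix.GeneralLinearGroup (Fin d) ℝ}
    (h : ∀ j, (lowerBlock g.1 j).det ≠ 0) :
    g • opp d = (isUpperUnipotent_upperFactor h).toGL • opp d := by
  set u := (isUpperUnipotent_upperFactor h).toGL with hu
  have e : u.1 = g.1 * Matrix.of fun q j =>
      if hq : j ≤ q then (lowerBlock g.1 j)⁻¹ ⟨q, hq⟩ ⟨j, le_rfl⟩ else 0 := by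
    ext i j
    rw [Matrix.mul_apply, hu, IsUpperUnipotent.coe_toGL, upperFactor]
    refine Fintype.sum_of_injective Subtype.val Subtype.val_injective _ _ (fun q hq => ?_)
      fun q => ?_
    · have : ¬ j ≤ q := fun hjq => hq ⟨⟨q, hjq⟩, rfl⟩
      simp [this]
    · simp [q.2]
  have e' : (g⁻¹ * u).1 = Matrix.of fun q j =>
      if hq : j ≤ q then (lowerBlock g.1 j)⁻¹ ⟨q, hq⟩ ⟨j, le_rfl⟩ else 0 := by
    rw [Units.val_mul, e, ← mul_assoc, g.inv_mul, one_mul]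
  have : (g⁻¹ * u) • opp d = opp d := by
    refine smul_opp_of_lower fun i j hij => ?_
    rw [e', Matrix.of_apply, dif_neg (not_le.2 hij)]
  rw [mul_smul, inv_smul_eq_iff] at this
  exact this.symm

theorem transverse_std_smul_opp_iff {g : Matrix.GeneralLinearGroup (Fin d) ℝ} :
    (std d).Transverse (g • opp d) ↔ ∀ j, (lowerBlock g.1 j).det ≠ 0 := by
  refine ⟨fun h => h.det_lowerBlock_ne_zero, fun h => ?_⟩
  have hU := isUpperUnipotent_upperFactor h
  rw [smul_opp_eq_upperFactor h, ← smul_std_of_upper (g := hU.toGL) fun i j hij => hU.upper i j hij]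
  exact transverse_std_opp.smul _

theorem longest_smul_opp : longest d • opp d = std d := by
  have : longest d * longest d = 1 := (longest d).val_inv |> Units.ext
  rw [opp, ← mul_smul, this, one_smul]

theorem continuous_det_lowerBlock (j : Fin d) :
    Continuous fun g : Matrix (Fin d) (Fin d) ℝ => (lowerBlock g j).det :=
  (continuous_id.matrix_submatrix _ _).matrix_det

theorem preimage_transverse_std :
    (fun g : Matrix.GeneralLinearGroup (Fin d) ℝ => g • std d) ⁻¹' {F | (std d).Transverse F} =
      {g | ∀ j, (lowerBlock (g * longest d).1 j).det ≠ 0} := by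
  ext g
  rw [Set.mem_preimage, Set.mem_ofPred_eq, Set.mem_ofPred_eq, ← transverse_std_smul_opp_iff,
    mul_smul, longest_smul_opp]

theorem isOpen_transverse_std : IsOpen {F : CompleteFlag d | (std d).Transverse F} := by
  rw [isOpen_coinduced, preimage_transverse_std]
  simp only [Set.ofPred_forall]
  exact isOpen_iInter_of_finite fun j => isOpen_ne_fun
    ((continuous_det_lowerBlock j).comp (Units.continuous_val.comp (continuous_mul_const _)))
    continuous_const

open Classical in
/-- The unipotent matrix taking the opposite flag to a given flag transverse to the standard one. -/
noncomputable def unipotentPart (F : CompleteFlag d) : Matrix.GeneralLinearGroup (Fin d) ℝ :=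
  if h : (std d).Transverse F then h.exists_unipotent.choose else 1

theorem isUpperUnipotent_unipotentPart (F : CompleteFlag d) :
    IsUpperUnipotent (unipotentPart F).1 := by
  unfold unipotentPart
  split_ifs with h
  · exact h.exists_unipotent.choose_spec.1
  · exact .one

theorem Transverse.unipotentPart_smul {F : CompleteFlag d} (h : (std d).Transverse F) :
    unipotentPart F • opp d = F := by
  rw [unipotentPart, dif_pos h]
  exact h.exists_unipotent.choose_spec.2.symm

theorem unipotentPart_smul_opp {u : Matrix.GeneralLinearGroup (Fin d) ℝ}
    (hu : IsUpperUnipotent u.1) : unipotentPart (u • opp d) = u := by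
  refine smul_opp_injOn (isUpperUnipotent_unipotentPart _) hu (Transverse.unipotentPart_smul ?_)
  rw [← smul_std_of_upper (g := u) fun i j hij => hu.upper i j hij]
  exact transverse_std_opp.smul _

theorem continuousOn_upperFactor : ContinuousOn (upperFactor (d := d))
    {g | ∀ j, (lowerBlock g j).det ≠ 0} := by
  refine continuousOn_pi.2 fun i => continuousOn_pi.2 fun j => ?_
  refine continuousOn_finsetSum _ fun q _ => ContinuousOn.mul ?_ ?_
  · exact (continuous_id.matrix_elem i q.1).continuousOn
  · simp only [Matrix.inv_def, Ring.inverse_eq_inv', Matrix.smul_apply, smul_eq_mul]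
    refine ContinuousOn.mul ?_ ?_
    · exact (continuous_det_lowerBlock j).continuousOn.inv₀ fun g hg => hg j
    · exact ((continuous_id.matrix_submatrix _ _).matrix_adjugate.matrix_elem _ _).continuousOn

/-- The topology is coinduced, so continuity is tested on the linear group, where the map is the
explicit rational function `upperFactor`. -/
theorem continuousOn_unipotentPart :
    ContinuousOn (fun F : CompleteFlag d => (unipotentPart F).1) {F | (std d).Transverse F} := by
  rw [continuousOn_open_iff isOpen_transverse_std]
  intro V hV
  rw [isOpen_coinduced, Set.preimage_inter, preimage_transverse_std]
  have hc : ContinuousOn (fun g : Matrix.GeneralLinearGroup (Fin d) ℝ =>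
      upperFactor (g * longest d).1) {g | ∀ j, (lowerBlock (g * longest d).1 j).det ≠ 0} :=
    continuousOn_upperFactor.comp
      (Units.continuous_val.comp (continuous_mul_const (longest d))).continuousOn fun g hg => hg
  have hopen := isOpen_transverse_std (d := d)
  rw [isOpen_coinduced, preimage_transverse_std] at hopen
  convert (continuousOn_open_iff hopen).1 hc V hV using 1
  ext g
  simp only [Set.mem_inter_iff, Set.mem_preimage, and_congr_right_iff]
  intro hg
  rw [← longest_smul_opp, ← mul_smul, smul_opp_eq_upperFactor hg,
    unipotentPart_smul_opp (isUpperUnipotent_upperFactor hg), IsUpperUnipotent.coe_toGL]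

theorem continuous_const_smul_flag (g : Matrix.GeneralLinearGroup (Fin d) ℝ) :
    Continuous fun F : CompleteFlag d => g • F := by
  refine continuous_coinduced_dom.2 ?_
  have : (fun F : CompleteFlag d => g • F) ∘
      (fun h : Matrix.GeneralLinearGroup (Fin d) ℝ => h • std d) =
      (fun h => h • std d) ∘ fun h => g * h := by
    ext1 h
    simp [mul_smul]
  rw [this]
  exact continuous_coinduced_rng.comp (continuous_const_mul g)

theorem mulVec_eq_sum_single (A : Matrix (Fin d) (Fin d) ℝ) (w : Fin d → ℝ) :
    A.mulVec w = ∑ j, w j • A.mulVec (Pi.single j 1) := by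
  ext i
  simp [Matrix.mulVec, dotProduct, mul_comm]

theorem smul_std_eq {P : Matrix.GeneralLinearGroup (Fin d) ℝ} {F : CompleteFlag d}
    (h : ∀ i, P.1.mulVec (Pi.single i 1) ∈ F.space i.succ) : P • std d = F := by
  refine eq_of_le fun k => ?_
  rintro v ⟨w, hw, rfl⟩
  rw [Matrix.mulVecLin_apply, mulVec_eq_sum_single]
  refine Submodule.sum_mem _ fun j _ => ?_
  by_cases hj : (k : ℕ) ≤ j
  · rw [mem_std.1 hw j hj, zero_smul]
    exact Submodule.zero_mem _
  · refine Submodule.smul_mem _ _ (F.mono ?_ (h j))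
    rw [Fin.le_def, Fin.val_succ]
    omega

theorem smul_opp_eq {P : Matrix.GeneralLinearGroup (Fin d) ℝ} {F : CompleteFlag d}
    (h : ∀ i, P.1.mulVec (Pi.single i 1) ∈ F.space i.castSucc.rev) : P • opp d = F := by
  refine eq_of_le fun k => ?_
  rintro v ⟨w, hw, rfl⟩
  rw [Matrix.mulVecLin_apply, mulVec_eq_sum_single]
  refine Submodule.sum_mem _ fun j _ => ?_
  by_cases hj : (j : ℕ) + k < d
  · rw [mem_opp.1 hw j hj, zero_smul]
    exact Submodule.zero_mem _
  · refine Submodule.smul_mem _ _ (F.mono ?_ (h j))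
    rw [Fin.le_def, Fin.val_rev, Fin.val_castSucc]
    omega

theorem single_mem_std (i : Fin d) : (Pi.single i 1 : Fin d → ℝ) ∈ (std d).space i.succ := by
  refine mem_std.2 fun j hj => Pi.single_eq_of_ne ?_ _
  rintro rfl
  rw [Fin.val_succ] at hj
  omega

theorem single_mem_opp (i : Fin d) :
    (Pi.single i 1 : Fin d → ℝ) ∈ (opp d).space i.castSucc.rev := by
  refine mem_opp.2 fun j hj => Pi.single_eq_of_ne ?_ _
  rintro rfl
  rw [Fin.val_rev, Fin.val_castSucc] at hj
  omega

end CompleteFlag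

/-! ### Positive tuples in matrix form and their reversal -/

open CompleteFlag

variable {d : ℕ}

theorem toMatrix_conj {B : Module.Basis (Fin d) ℝ (Fin d → ℝ)}
    {P : Matrix.GeneralLinearGroup (Fin d) ℝ} (h : ∀ j, P.1.mulVec (Pi.single j 1) = B j)
    (U : Matrix.GeneralLinearGroup (Fin d) ℝ) :
    LinearMap.toMatrix B B (Matrix.mulVecLin (P * U * P⁻¹).1) = U.1 := by
  have : Matrix.mulVecLin (P * U * P⁻¹).1 = Matrix.toLin B B U.1 := by
    refine B.ext fun j => ?_
    have e : (P * U * P⁻¹).1 * P.1 = P.1 * U.1 := by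
      rw [← Units.val_mul, ← Units.val_mul, inv_mul_cancel_right]
    rw [Matrix.toLin_self, Matrix.mulVecLin_apply, ← h j, Matrix.mulVec_mulVec, e,
      ← Matrix.mulVec_mulVec, mulVec_eq_sum_single]
    simp [h]
  rw [this, LinearMap.toMatrix_toLin]

/-- Conjugation by `P`, as a map to the projective linear group. -/
def conjMk (P : Matrix.GeneralLinearGroup (Fin d) ℝ) :
    Matrix.GeneralLinearGroup (Fin d) ℝ →* Matrix.ProjGenLinGroup (Fin d) ℝ :=
  Matrix.ProjGenLinGroup.mk.comp (MulAut.conj P).toMonoidHom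

theorem conjMk_apply (P U : Matrix.GeneralLinearGroup (Fin d) ℝ) :
    conjMk P U = Matrix.ProjGenLinGroup.mk (P * U * P⁻¹) := rfl

theorem prod_conjMk_smul (P : Matrix.GeneralLinearGroup (Fin d) ℝ) {m : ℕ}
    (U : Fin m → Matrix.GeneralLinearGroup (Fin d) ℝ) (j : ℕ) :
    (((List.ofFn fun i => conjMk P (U i)).drop j).reverse).prod • (P • opp d) =
      (P * ((List.ofFn U).drop j).reverse.prod) • opp d := by
  have : (List.ofFn fun i => conjMk P (U i)) = (List.ofFn U).map (conjMk P) := by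
    rw [List.map_ofFn]; rfl
  rw [this, ← List.map_drop, ← List.map_reverse, ← map_list_prod, conjMk_apply, mk_smul, ← mul_smul,
    inv_mul_cancel_right]

/-- The columns of P are the basis adapted to both end flags, and the elements of U_{>0} become
PUP⁻¹. Transversality of the end flags is then automatic. -/
theorem isPositiveTuple_iff {m : ℕ} {F : Fin (m + 3) → CompleteFlag d} :
    IsPositiveTuple F ↔ ∃ (P : Matrix.GeneralLinearGroup (Fin d) ℝ)
      (U : Fin (m + 1) → Matrix.GeneralLinearGroup (Fin d) ℝ),
      (∀ j, IsTotallyPositiveUnipotent (U j).1) ∧ F 0 = P • std d ∧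
      F (Fin.last (m + 2)) = P • opp d ∧
      ∀ j : Fin (m + 1),
        F j.succ.castSucc = (P * ((List.ofFn U).drop j).reverse.prod) • opp d := by
  constructor
  · rintro ⟨-, B, u, hB, hu, hF⟩
    let P : Matrix.GeneralLinearGroup (Fin d) ℝ :=
      ⟨(Pi.basisFun ℝ (Fin d)).toMatrix B, B.toMatrix (Pi.basisFun ℝ (Fin d)),
        Module.Basis.toMatrix_mul_toMatrix_flip _ _, Module.Basis.toMatrix_mul_toMatrix_flip _ _⟩
    have hP : ∀ j, P.1.mulVec (Pi.single j 1) = B j := by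
      intro j
      ext i
      rw [Matrix.mulVec_single_one]
      simp [P, Module.Basis.toMatrix_apply]
    choose g hgu hg using hu
    have hconj : ∀ j, P * (P⁻¹ * g j * P) * P⁻¹ = g j := fun j => by group
    have hu' : u = fun j => conjMk P (P⁻¹ * g j * P) := by
      ext1 j
      rw [conjMk_apply, hconj, hgu]
    have h0 : F 0 = P • std d := (smul_std_eq fun i => by rw [hP]; exact (hB i).1).symm
    have h1 : F (Fin.last (m + 2)) = P • opp d :=
      (smul_opp_eq fun i => by rw [hP]; exact (hB i).2).symm
    refine ⟨P, fun j => P⁻¹ * g j * P, fun j => ?_, h0, h1, fun j => ?_⟩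
    · have := hg j
      rwa [← hconj j, toMatrix_conj hP] at this
    · rw [hF, h1, hu', prod_conjMk_smul]
  · rintro ⟨P, U, hU, h0, h1, hF⟩
    let B := (Pi.basisFun ℝ (Fin d)).map (LinearEquiv.ofBijective (Matrix.mulVecLin P.1)
      ⟨Matrix.mulVec_injective_of_isUnit P.isUnit, Matrix.mulVec_surjective_iff_isUnit.2 P.isUnit⟩)
    have hP : ∀ j, P.1.mulVec (Pi.single j 1) = B j := by
      intro j
      simp only [B, Module.Basis.map_apply, Pi.basisFun_apply]
      rfl
    refine ⟨by rw [h0, h1]; exact transverse_std_opp.smul P, B, fun j => conjMk P (U j),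
      fun i => ⟨?_, ?_⟩, fun j => ⟨_, rfl, ?_⟩, fun j => ?_⟩
    · rw [h0, ← hP]
      exact mem_smul.2 ⟨_, single_mem_std i, rfl⟩
    · rw [h1, ← hP]
      exact mem_smul.2 ⟨_, single_mem_opp i, rfl⟩
    · exact (toMatrix_conj hP (U j)).symm ▸ hU j
    · rw [hF, h1, prod_conjMk_smul]

theorem isPositiveTuple_triple_iff {F₁ F₂ F₃ : CompleteFlag d} :
    IsPositiveTuple ![F₁, F₂, F₃] ↔ ∃ P U : Matrix.GeneralLinearGroup (Fin d) ℝ,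
      IsTotallyPositiveUnipotent U.1 ∧ F₁ = P • std d ∧ F₃ = P • opp d ∧
        F₂ = (P * U) • opp d := by
  rw [isPositiveTuple_iff]
  constructor
  · rintro ⟨P, U, hU, h0, h1, h2⟩
    exact ⟨P, U 0, hU 0, h0, h1, by simpa using h2 0⟩
  · rintro ⟨P, U, hU, h0, h1, h2⟩
    refine ⟨P, fun _ => U, fun _ => hU, h0, h1, fun j => ?_⟩
    obtain rfl : j = 0 := Fin.ext (by omega)
    simpa using h2

/-- With the columns listed backwards, the sign of the minor depends only on its size k, not on the
first row i. -/
theorem det_consecutive_pos {U : Matrix (Fin d) (Fin d) ℝ} (hU : IsTotallyPositiveUnipotent U)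
    {i k : ℕ} (h : i + k ≤ d) :
    0 < (Equiv.Perm.sign (Fin.revPerm : Equiv.Perm (Fin k)) : ℝ) *
      (U.submatrix (fun p : Fin k => ⟨i + p, by omega⟩)
        fun q : Fin k => Fin.rev ⟨q, by omega⟩).det := by
  have := hU.minor_pos k
    (OrderEmbedding.ofStrictMono (fun p => ⟨i + p, by omega⟩) fun a b hab =>
      Nat.add_lt_add_left hab i)
    (OrderEmbedding.ofStrictMono (fun q => Fin.rev ⟨q.rev, by omega⟩) fun a b hab =>
      Fin.rev_lt_rev.2 (Fin.rev_lt_rev.2 hab)) fun p => by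
      change i + (p : ℕ) ≤ d - (k - (p + 1) + 1)
      omega
  rw [← Matrix.det_permute']
  exact this

/-- Reversing a positive triple yields a positive triple. -/
theorem IsPositiveTuple.reverse {F₁ F₂ F₃ : CompleteFlag d} (h : IsPositiveTuple ![F₁, F₂, F₃])
    (h23 : F₂.Transverse F₃) : IsPositiveTuple ![F₃, F₂, F₁] := by
  rw [isPositiveTuple_triple_iff] at h ⊢
  obtain ⟨P, U, hU, rfl, rfl, rfl⟩ := h
  have htr : (std d).Transverse ((longest d * U) • opp d) := by
    have := (h23.smul (longest d * P⁻¹)).symm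
    rwa [← mul_smul, ← mul_smul, inv_mul_cancel_right, longest_smul_opp, mul_assoc (longest d),
      inv_mul_cancel_left] at this
  -- Replacing P by `P * longest d` exchanges the end flags; V is the new unipotent coordinate of
  -- the middle one.
  obtain ⟨V, hV, hVo⟩ := htr.exists_unipotent
  have hll : longest d * longest d = 1 := (longest d).val_inv |> Units.ext
  refine ⟨P * longest d, V, ?_, ?_, ?_, ?_⟩
  · obtain ⟨b, hb⟩ : ∃ b, b = (longest d * U)⁻¹ * V := ⟨_, rfl⟩
    have hbl : ∀ i j, i < j → b.1 i j = 0 :=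
      lower_of_smul_opp (by rw [hb, mul_smul, ← hVo, inv_smul_smul])
    have hVb : V.1 = (longest d * U).1 * b.1 := by
      rw [← Units.val_mul, hb, mul_inv_cancel_left]
    have hwU : ∀ i j, (longest d * U).1 i j = U.1 i.rev j := fun i j =>
      longest_mulVec (fun i => U.1 i j) i
    refine IsLowerTP.isTotallyPositiveUnipotent hV (.of_consecutive hV.isLowerUnipotent ?_)
    -- The last k columns of the lower triangular b are supported in the last k rows, so the minor
    -- factors; the second factor does not depend on i.
    have key : ∀ i k (hik : i + k ≤ d),
        natMinor (revExtend V.1) (fun p : Fin k => i + p) (fun q => (q : ℕ)) =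
        (U.1.submatrix (fun p : Fin k => ⟨i + p, by omega⟩)
          fun q : Fin k => Fin.rev ⟨q, by omega⟩).det *
        (b.1.submatrix (fun q : Fin k => Fin.rev ⟨q, by omega⟩)
          fun q : Fin k => Fin.rev ⟨q, by omega⟩).det := by
      intro i k hik
      rw [natMinor_revExtend V.1 (fun p => by omega) (fun p => by omega), ← Matrix.det_mul]
      congr 1
      ext p q
      rw [Matrix.submatrix_apply, hVb, Matrix.mul_apply, Matrix.mul_apply]
      refine (Fintype.sum_of_injective (fun q : Fin k => Fin.rev ⟨q, by omega⟩) ?_ _ _ ?_ ?_).symm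
      · intro a b hab
        simpa [Fin.ext_iff] using Fin.rev_injective hab
      · intro r hr
        rw [hbl, mul_zero]
        by_contra! hlt
        refine hr ⟨⟨r.rev, ?_⟩, ?_⟩
        · rw [Fin.le_def, Fin.val_rev] at hlt
          rw [Fin.val_rev]
          dsimp only at hlt
          omega
        · ext
          simp only [Fin.val_rev]
          omega
      · intro r
        rw [hwU, Fin.rev_rev]
        rfl
    intro i k hik
    -- For i = 0 the minor of V is 1, which fixes the sign of the factor from b.
    have h0 : natMinor (revExtend V.1) (fun p : Fin k => 0 + p) (fun q => (q : ℕ)) = 1 := by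
      unfold natMinor
      have hL := hV.isLowerUnipotent
      rw [Matrix.det_of_isLowerTriangular, Finset.prod_eq_one]
      · intro p _
        simp only [Matrix.of_apply, zero_add]
        exact hL.diag _ (by omega)
      · intro p q hpq
        simp only [Matrix.of_apply, zero_add]
        exact hL.lower _ _ hpq (by omega)
    have hi := det_consecutive_pos hU hik
    have hz := det_consecutive_pos hU (i := 0) (k := k) (by omega)
    rw [key _ _ (by omega)] at h0
    rw [key _ _ hik]
    set c := (b.1.submatrix (fun q : Fin k => Fin.rev ⟨q, by omega⟩)
          fun q : Fin k => Fin.rev ⟨q, by omega⟩).det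
    rcases Int.units_eq_one_or (Equiv.Perm.sign (Fin.revPerm : Equiv.Perm (Fin k))) with hs | hs
    · simp only [hs, Units.val_one, Int.cast_one, one_mul] at hi hz
      exact mul_pos hi ((mul_pos_iff_of_pos_left hz).1 (h0 ▸ one_pos))
    · simp only [hs, Units.val_neg, Units.val_one, Int.cast_neg, Int.cast_one, neg_mul, one_mul,
        neg_pos] at hi hz
      exact mul_pos_of_neg_of_neg hi (by
        by_contra! hc
        exact absurd h0 (mul_nonpos_of_nonpos_of_nonneg hz.le hc |>.trans_lt one_pos).ne)
  · rw [mul_smul]; rfl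
  · rw [mul_smul, longest_smul_opp]
  · rw [mul_smul _ V, ← hVo, ← mul_smul, mul_assoc, ← mul_assoc (longest d), hll, one_mul]

/-! ### Positivity along a continuous family of flags -/

theorem prod_drop_ofFn_inv_mul {G : Type*} [Group G] {n : ℕ} (c : Fin (n + 1) → G)
    (j : Fin (n + 1)) :
    ((List.ofFn fun i : Fin n => (c i.succ)⁻¹ * c i.castSucc).drop j).reverse.prod =
      (c (Fin.last n))⁻¹ * c j := by
  induction n with
  | zero =>
    obtain rfl : j = 0 := Fin.ext (by omega)
    simp
  | succ n ih =>
    rw [List.ofFn_succ]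
    have ih' := fun j => ih (fun i => c i.succ) j
    simp only [Fin.succ_last, Fin.succ_castSucc] at ih'
    induction j using Fin.cases with
    | zero =>
      have := ih' 0
      simp only [Fin.val_zero, List.drop_zero] at this
      simp only [Fin.val_zero, List.drop_zero, List.reverse_cons, List.prod_append, this,
        List.prod_singleton, Fin.castSucc_zero]
      group
    | succ j =>
      rw [Fin.val_succ, List.drop_succ_cons]
      exact ih' j

theorem isOpen_setOf_isTotallyPositiveUnipotent {X : Type*} [TopologicalSpace X]
    {h : X → Matrix (Fin d) (Fin d) ℝ} {s : Set X} (hs : IsOpen s) (hc : ContinuousOn h s)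
    (hU : ∀ x ∈ s, IsUpperUnipotent (h x)) :
    IsOpen {x | x ∈ s ∧ IsTotallyPositiveUnipotent (h x)} := by
  rw [isOpen_iff_mem_nhds]
  rintro x ⟨hx, hTP⟩
  have hca := hc.continuousAt (hs.mem_nhds hx)
  have : ∀ᶠ y in 𝓝 x, ∀ (k : Fin (d + 1)) (I J : Fin k ↪o Fin d), (∀ p, I p ≤ J p) →
      0 < ((h y).submatrix I J).det := by
    refine eventually_all.2 fun k => ?_
    have : Finite (Fin k ↪o Fin d) := DFunLike.finite _
    refine eventually_all.2 fun I => eventually_all.2 fun J => eventually_imp_distrib_left.2 ?_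
    intro hIJ
    have : Continuous fun A : Matrix (Fin d) (Fin d) ℝ => (A.submatrix I J).det :=
      (continuous_id.matrix_submatrix _ _).matrix_det
    exact (this.continuousAt.comp hca).eventually_const_lt (hTP.minor_pos k I J hIJ)
  filter_upwards [this, hs.mem_nhds hx] with y hy hys
  refine ⟨hys, (hU y hys).upper, (hU y hys).diag, fun k I J hIJ => ?_⟩
  have hk : k ≤ d := by simpa using Fintype.card_le_of_embedding I.toEmbedding
  exact hy ⟨k, by omega⟩ I J hIJ

/-- A continuous family of flags, transverse to `F` and to each other, is given by totally positive
matrices as soon as two of its members are. -/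
theorem exists_unipotent_family {F : CompleteFlag d} {f : ℝ → CompleteFlag d} {T : ℝ}
    (hf : Continuous f) (hF : ∀ s ∈ Set.Ioo 0 T, F.Transverse (f s))
    (hff : ∀ s ∈ Set.Ioo 0 T, ∀ t ∈ Set.Ioo 0 T, s ≠ t → (f s).Transverse (f t))
    {s₀ t₀ : ℝ} (hs₀ : s₀ ∈ Set.Ioo 0 T) (ht₀ : t₀ ∈ Set.Ioo 0 T) (hst : s₀ < t₀)
    (hpos : IsPositiveTuple ![F, f s₀, f t₀]) :
    ∃ (P : Matrix.GeneralLinearGroup (Fin d) ℝ) (γ : ℝ → Matrix.GeneralLinearGroup (Fin d) ℝ),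
      F = P • std d ∧ (∀ s, IsUpperUnipotent (γ s).1) ∧
      (∀ s ∈ Set.Ioo 0 T, f s = (P * γ s) • opp d) ∧
      ∀ s ∈ Set.Ioo 0 T, ∀ t ∈ Set.Ioo 0 T, s < t →
        IsTotallyPositiveUnipotent ((γ t)⁻¹ * γ s).1 := by
  obtain ⟨P, U, hU, rfl, h3, h2⟩ := isPositiveTuple_triple_iff.1 hpos
  let γ : ℝ → Matrix.GeneralLinearGroup (Fin d) ℝ := fun s => unipotentPart (P⁻¹ • f s)
  have htr : ∀ s ∈ Set.Ioo 0 T, (std d).Transverse (P⁻¹ • f s) := fun s hs => by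
    simpa only [inv_smul_smul] using (hF s hs).smul P⁻¹
  have hγU : ∀ s, IsUpperUnipotent (γ s).1 := fun s => isUpperUnipotent_unipotentPart _
  have hγ : ∀ s ∈ Set.Ioo 0 T, f s = (P * γ s) • opp d := fun s hs => by
    rw [mul_smul, (htr s hs).unipotentPart_smul, smul_inv_smul]
  have hγc : ContinuousOn (fun s => (γ s).1) (Set.Ioo 0 T) :=
    continuousOn_unipotentPart.comp ((continuous_const_smul_flag P⁻¹).comp hf).continuousOn htr
  -- The determinant is 1, so the inverse is the adjugate, which is polynomial in the entries.
  have hγi : ContinuousOn (fun s => (γ s)⁻¹.1) (Set.Ioo 0 T) := by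
    have : (fun s => (γ s)⁻¹.1) = fun s => (γ s).1.adjugate := by
      ext1 s
      rw [Matrix.coe_units_inv, Matrix.inv_def, (hγU s).det]
      simp
    rw [this]
    exact (continuous_id.matrix_adjugate).comp_continuousOn hγc
  let Δ : Set (ℝ × ℝ) := {p | 0 < p.1 ∧ p.1 < p.2 ∧ p.2 < T}
  have hΔ1 : ∀ p ∈ Δ, p.1 ∈ Set.Ioo 0 T := fun p hp => ⟨hp.1, hp.2.1.trans hp.2.2⟩
  have hΔ2 : ∀ p ∈ Δ, p.2 ∈ Set.Ioo 0 T := fun p hp => ⟨hp.1.trans hp.2.1, hp.2.2⟩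
  have hΔo : IsOpen Δ :=
    (isOpen_lt continuous_const continuous_fst).inter
      ((isOpen_lt continuous_fst continuous_snd).inter (isOpen_lt continuous_snd continuous_const))
  have hΔc : Convex ℝ Δ := by
    have e1 : Convex ℝ {p : ℝ × ℝ | 0 < p.1} :=
      convex_halfSpace_gt (IsLinearMap.mk (by simp) (by simp)) 0
    have e2 : Convex ℝ {p : ℝ × ℝ | p.2 < T} :=
      convex_halfSpace_lt (IsLinearMap.mk (by simp) (by simp)) T
    have e3 : Convex ℝ {p : ℝ × ℝ | 0 < p.2 - p.1} :=
      convex_halfSpace_gt (IsLinearMap.mk (fun x y => by simp; ring) fun c x => by simp; ring) 0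
    convert e1.inter (e3.inter e2) using 1
    ext p
    simp [Δ]
  let h : ℝ × ℝ → Matrix (Fin d) (Fin d) ℝ := fun p => ((γ p.2)⁻¹ * γ p.1).1
  have hhU : ∀ p, IsUpperUnipotent (h p) := fun p => (hγU _).inv.mul (hγU _)
  have hhc : ContinuousOn h Δ :=
    (hγi.comp continuous_snd.continuousOn hΔ2).mul (hγc.comp continuous_fst.continuousOn hΔ1)
  have hmem : (s₀, t₀) ∈ Δ := ⟨hs₀.1, hst, ht₀.2⟩
  have hbase : IsTotallyPositiveUnipotent (h (s₀, t₀)) := by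
    have e1 : γ s₀ = U := by
      change unipotentPart _ = _
      rw [h2, mul_smul, inv_smul_smul, unipotentPart_smul_opp hU.isUpperUnipotent]
    have e2 : γ t₀ = 1 := by
      change unipotentPart _ = _
      rw [h3, inv_smul_smul]
      conv_lhs => rw [← one_smul (Matrix.GeneralLinearGroup (Fin d) ℝ) (opp d)]
      exact unipotentPart_smul_opp .one
    simpa [h, e1, e2] using hU
  -- The totally positive locus is open, nonempty and relatively closed in the connected set `Δ`.
  have hsub : Δ ⊆ {p | p ∈ Δ ∧ IsTotallyPositiveUnipotent (h p)} := by
    refine hΔc.isPreconnected.subset_of_closure_inter_subset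
      (isOpen_setOf_isTotallyPositiveUnipotent hΔo hhc fun p _ => hhU p)
      ⟨_, hmem, hmem, hbase⟩ ?_
    rintro p ⟨hpc, hp⟩
    refine ⟨hp, IsLowerTP.isTotallyPositiveUnipotent (hhU p) ?_⟩
    have := mem_closure_iff_nhdsWithin_neBot.1 hpc
    have hlim := (hhc.continuousAt (hΔo.mem_nhds hp)).tendsto.mono_left
      (nhdsWithin_le_nhds (s := {p | p ∈ Δ ∧ IsTotallyPositiveUnipotent (h p)}))
    refine IsLowerTP.of_tendsto (a := fun p => revExtend (h p))
      (l := 𝓝[{p | p ∈ Δ ∧ IsTotallyPositiveUnipotent (h p)}] p)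
      (eventually_nhdsWithin_of_forall fun q (hq : q ∈ Δ ∧ IsTotallyPositiveUnipotent (h q)) =>
        hq.2.isLowerTP) (fun i j hi hj => ?_)
      fun k hk => ?_
    · simp only [revExtend_of_lt _ hi hj]
      exact tendsto_pi_nhds.1 (tendsto_pi_nhds.1 hlim _) _
    · refine Transverse.corner_ne_zero (g := (γ p.2)⁻¹ * γ p.1) ?_ hk
      have := (hff _ (hΔ1 p hp) _ (hΔ2 p hp) hp.2.1.ne).smul ((P * γ p.2)⁻¹)
      rwa [hγ _ (hΔ1 p hp), hγ _ (hΔ2 p hp), inv_smul_smul, ← mul_smul, mul_inv_rev, mul_assoc,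
        inv_mul_cancel_left] at this
  exact ⟨P, γ, rfl, hγU, hγ, fun s hs t ht hst => (hsub (a := (s, t)) ⟨hs.1, hst, ht.2⟩).2⟩

/-- Right multiplication of P by the last γ keeps P·std, since γ is upper triangular, and moves
P·opp to the last flag; quotients of successive γ's are the required factors. -/
theorem isPositiveTuple_of_family {F : CompleteFlag d} {f : ℝ → CompleteFlag d} {T : ℝ}
    (hf : Continuous f) (hF : ∀ s ∈ Set.Ioo 0 T, F.Transverse (f s))
    (hff : ∀ s ∈ Set.Ioo 0 T, ∀ t ∈ Set.Ioo 0 T, s ≠ t → (f s).Transverse (f t))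
    {s₀ t₀ : ℝ} (hs₀ : s₀ ∈ Set.Ioo 0 T) (ht₀ : t₀ ∈ Set.Ioo 0 T) (hst : s₀ < t₀)
    (hpos : IsPositiveTuple ![F, f s₀, f t₀]) {m : ℕ} {s : Fin (m + 2) → ℝ} (hs : StrictMono s)
    (hsT : ∀ i, s i ∈ Set.Ioo 0 T) :
    IsPositiveTuple (Fin.cons F fun i => f (s i) : Fin (m + 3) → CompleteFlag d) := by
  obtain ⟨P, γ, hP, hγU, hγ, hTP⟩ := exists_unipotent_family hf hF hff hs₀ ht₀ hst hpos
  rw [isPositiveTuple_iff]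
  refine ⟨P * γ (s (Fin.last _)), fun j => (γ (s j.succ))⁻¹ * γ (s j.castSucc),
    fun j => hTP _ (hsT _) _ (hsT _) (hs j.castSucc_lt_succ), ?_, ?_, fun j => ?_⟩
  · rw [Fin.cons_zero, mul_smul, smul_std_of_upper fun i j hij => (hγU _).upper i j hij, hP]
  · rw [← Fin.succ_last, Fin.cons_succ, hγ _ (hsT _)]
  · have := prod_drop_ofFn_inv_mul (fun i => γ (s i)) j.castSucc
    rw [Fin.val_castSucc] at this
    rw [this, ← Fin.succ_castSucc, Fin.cons_succ, hγ _ (hsT _), mul_assoc, mul_inv_cancel_left]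

/-! ### Changing the base point on the circle -/

/-- The triples of points at `x`, and at clockwise angles `s < t` from `x`, are positive. -/
def PositiveAt (ξ : Circle → CompleteFlag d) (x : Circle) : Prop :=
  ∀ s ∈ Set.Ioo 0 (2 * Real.pi), ∀ t ∈ Set.Ioo 0 (2 * Real.pi), s < t →
    IsPositiveTuple ![ξ x, ξ (x * Circle.exp (-s)), ξ (x * Circle.exp (-t))]

theorem Circle.exp_neg_injOn {s t : ℝ} (hs : s ∈ Set.Ico 0 (2 * Real.pi))
    (ht : t ∈ Set.Ico 0 (2 * Real.pi)) (h : Circle.exp (-s) = Circle.exp (-t)) : s = t := by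
  obtain ⟨m, hm⟩ := Circle.exp_eq_exp.1 h
  have hpi := Real.pi_pos
  have h1 : (m : ℝ) < 1 := by
    by_contra! hc
    nlinarith [hs.1, hs.2, ht.1, ht.2]
  have h2 : (-1 : ℝ) < m := by
    by_contra! hc
    nlinarith [hs.1, hs.2, ht.1, ht.2]
  have h1' : m < 1 := by exact_mod_cast h1
  have h2' : -1 < m := by exact_mod_cast h2
  obtain rfl : m = 0 := by omega
  simp at hm
  exact hm

theorem Circle.exists_eq_mul_exp_neg {x y : Circle} (h : x ≠ y) :
    ∃ s ∈ Set.Ioo 0 (2 * Real.pi), y = x * Circle.exp (-s) := by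
  obtain ⟨a, ha⟩ := Circle.exp_surjective (x / y)
  have e : Circle.exp (toIcoMod Real.two_pi_pos 0 a) = x / y := by
    rw [← ha, Circle.exp_eq_exp]
    refine ⟨-toIcoDiv Real.two_pi_pos 0 a, ?_⟩
    rw [toIcoMod, zsmul_eq_mul]
    push_cast
    ring
  have hm := toIcoMod_mem_Ico Real.two_pi_pos 0 a
  rw [zero_add] at hm
  refine ⟨_, ⟨hm.1.lt_of_ne ?_, hm.2⟩, ?_⟩
  · intro h0
    rw [← h0, Circle.exp_zero] at e
    exact h (div_eq_one.1 e.symm)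
  · rw [Circle.exp_neg, e]
    simp

theorem Circle.ne_mul_exp_neg (x : Circle) {s : ℝ} (hs : s ∈ Set.Ioo 0 (2 * Real.pi)) :
    x ≠ x * Circle.exp (-s) := by
  intro h
  have h' : Circle.exp (-0) = Circle.exp (-s) := by
    rw [neg_zero, Circle.exp_zero]
    exact mul_left_cancel ((mul_one x).trans h)
  exact hs.1.ne (Circle.exp_neg_injOn ⟨le_rfl, Real.two_pi_pos⟩ ⟨hs.1.le, hs.2⟩ h')

section Circle

variable {ξ : Circle → CompleteFlag d}

theorem continuous_arc (hξ : Continuous ξ) (x : Circle) :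
    Continuous fun s : ℝ => ξ (x * Circle.exp (-s)) :=
  hξ.comp (continuous_const.mul (Circle.exp.continuous.comp continuous_neg))

theorem transverse_base (htrans : IsTransverseMap ξ) (x : Circle) {s : ℝ}
    (hs : s ∈ Set.Ioo 0 (2 * Real.pi)) : (ξ x).Transverse (ξ (x * Circle.exp (-s))) :=
  htrans _ _ (Circle.ne_mul_exp_neg x hs)

theorem transverse_arc (htrans : IsTransverseMap ξ) (x : Circle) {s t : ℝ}
    (hs : s ∈ Set.Ioo 0 (2 * Real.pi)) (ht : t ∈ Set.Ioo 0 (2 * Real.pi)) (hst : s ≠ t) :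
    (ξ (x * Circle.exp (-s))).Transverse (ξ (x * Circle.exp (-t))) :=
  htrans _ _ fun h => hst (Circle.exp_neg_injOn ⟨hs.1.le, hs.2⟩ ⟨ht.1.le, ht.2⟩ (mul_left_cancel h))

theorem isPositiveTuple_of_arc (hξ : Continuous ξ) (htrans : IsTransverseMap ξ) {x : Circle}
    {s₀ t₀ : ℝ} (hs₀ : s₀ ∈ Set.Ioo 0 (2 * Real.pi)) (ht₀ : t₀ ∈ Set.Ioo 0 (2 * Real.pi))
    (hst : s₀ < t₀)
    (hpos : IsPositiveTuple ![ξ x, ξ (x * Circle.exp (-s₀)), ξ (x * Circle.exp (-t₀))])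
    {m : ℕ} {s : Fin (m + 2) → ℝ} (hs : StrictMono s)
    (hsT : ∀ i, s i ∈ Set.Ioo 0 (2 * Real.pi)) :
    IsPositiveTuple
      (Fin.cons (ξ x) fun i => ξ (x * Circle.exp (-s i)) : Fin (m + 3) → CompleteFlag d) :=
  isPositiveTuple_of_family (continuous_arc hξ x) (fun _ hs => transverse_base htrans x hs)
    (fun _ hs _ ht hst => transverse_arc htrans x hs ht hst) hs₀ ht₀ hst hpos hs hsT

theorem PositiveAt.of_exists (hξ : Continuous ξ) (htrans : IsTransverseMap ξ) {x : Circle}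
    {s₀ t₀ : ℝ} (hs₀ : s₀ ∈ Set.Ioo 0 (2 * Real.pi)) (ht₀ : t₀ ∈ Set.Ioo 0 (2 * Real.pi))
    (hst : s₀ < t₀)
    (hpos : IsPositiveTuple ![ξ x, ξ (x * Circle.exp (-s₀)), ξ (x * Circle.exp (-t₀))]) :
    PositiveAt ξ x := by
  intro s hs t ht hst'
  have := isPositiveTuple_of_arc hξ htrans hs₀ ht₀ hst hpos (m := 0) (s := ![s, t])
    (by simpa using hst') (fun i => by fin_cases i <;> assumption)
  convert this using 1
  ext1 i
  fin_cases i <;> rfl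

theorem IsTransverseMap.comp_inv (htrans : IsTransverseMap ξ) :
    IsTransverseMap fun w => ξ w⁻¹ :=
  fun _ _ h => htrans _ _ fun h' => h (inv_injective h')

/-- Positivity at `x` for one orientation gives positivity at every other point for the opposite
orientation. -/
theorem PositiveAt.comp_inv (hξ : Continuous ξ) (htrans : IsTransverseMap ξ) {x y : Circle}
    (h : PositiveAt ξ x) (hxy : x ≠ y) : PositiveAt (fun w => ξ w⁻¹) y⁻¹ := by
  -- The triple x, midpoint of the arc, y is read backwards; inversion of the circle makes it
  -- clockwise from y⁻¹.
  obtain ⟨t, ht, rfl⟩ := Circle.exists_eq_mul_exp_neg hxy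
  have hs : t / 2 ∈ Set.Ioo 0 (2 * Real.pi) := ⟨half_pos ht.1, (half_lt_self ht.1).trans ht.2⟩
  have := (h _ hs t ht (half_lt_self ht.1)).reverse
    (transverse_arc htrans x hs ht (half_lt_self ht.1).ne)
  refine PositiveAt.of_exists (hξ.comp continuous_inv) htrans.comp_inv hs ht (half_lt_self ht.1) ?_
  have e1 : ((x * Circle.exp (-t))⁻¹ * Circle.exp (-(t / 2)))⁻¹ = x * Circle.exp (-(t / 2)) := by
    rw [mul_inv_rev, inv_inv, ← Circle.exp_neg, neg_neg, mul_comm, mul_assoc, ← Circle.exp_add]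
    ring_nf
  have e2 : ((x * Circle.exp (-t))⁻¹ * Circle.exp (-t))⁻¹ = x := by
    rw [mul_inv_rev, inv_inv, mul_comm x, inv_mul_cancel_left]
  simpa only [Function.comp_apply, e1, e2, inv_inv] using this

theorem PositiveAt.of_inv (hξ : Continuous ξ) (htrans : IsTransverseMap ξ) {x y : Circle}
    (h : PositiveAt (fun w => ξ w⁻¹) x⁻¹) (hxy : x ≠ y) : PositiveAt ξ y := by
  have := PositiveAt.comp_inv (ξ := fun w => ξ w⁻¹) (hξ.comp continuous_inv) htrans.comp_inv h
    fun h' => hxy (inv_injective h')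
  simpa only [inv_inv] using this

/-- Two changes of base point, via the midpoint of an arc from x to y, restore the orientation. -/
theorem PositiveAt.forall (hξ : Continuous ξ) (htrans : IsTransverseMap ξ) {x : Circle}
    (h : PositiveAt ξ x) (y : Circle) : PositiveAt ξ y := by
  by_cases hxy : x = y
  · exact hxy ▸ h
  obtain ⟨s, hs, rfl⟩ := Circle.exists_eq_mul_exp_neg hxy
  have hs2 : s / 2 ∈ Set.Ioo 0 (2 * Real.pi) := ⟨half_pos hs.1, (half_lt_self hs.1).trans hs.2⟩
  have hne : x * Circle.exp (-(s / 2)) ≠ x * Circle.exp (-s) := fun h' => (half_lt_self hs.1).ne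
    (Circle.exp_neg_injOn ⟨hs2.1.le, hs2.2⟩ ⟨hs.1.le, hs.2⟩ (mul_left_cancel h'))
  exact (h.comp_inv hξ htrans (Circle.ne_mul_exp_neg x hs2)).of_inv hξ htrans hne

theorem PositiveAt.isPositiveMap (hξ : Continuous ξ) (htrans : IsTransverseMap ξ)
    (h : ∀ x, PositiveAt ξ x) : IsPositiveMap ξ := by
  rintro m a ⟨θ, hθ, hlt, ha⟩
  -- The angles 1 and 2 are arbitrary points of (0, 2π).
  have := isPositiveTuple_of_arc hξ htrans (x := a 0) (s₀ := 1) (t₀ := 2)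
    ⟨by norm_num, by linarith [Real.pi_gt_three]⟩ ⟨by norm_num, by linarith [Real.pi_gt_three]⟩
    (by norm_num)
    (h _ _ ⟨by norm_num, by linarith [Real.pi_gt_three]⟩ _
      ⟨by norm_num, by linarith [Real.pi_gt_three]⟩ (by norm_num))
    (s := fun i : Fin (m + 2) => θ 0 - θ i.succ)
    (fun i j hij => sub_lt_sub_left (hθ (Fin.succ_lt_succ_iff.2 hij)) _)
    fun i => ⟨sub_pos.2 (hθ i.succ_pos), hlt _ _⟩
  convert this using 1
  ext1 i
  induction i using Fin.cases with
  | zero => rfl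
  | succ i =>
    rw [Fin.cons_succ, ← ha i.succ, ← ha 0, ← Circle.exp_add]
    ring_nf

end Circle

end

theorem mainTheorem3 (d : ℕ) (ξ : Circle → CompleteFlag d) (hξ : Continuous ξ)
    (htrans : IsTransverseMap ξ)
    (hpos : ∃ x y z : Circle, x ≠ y ∧ y ≠ z ∧ x ≠ z ∧ IsPositiveTuple ![ξ x, ξ y, ξ z]) :
    IsPositiveMap ξ := by
  obtain ⟨x, y, z, hxy, hyz, hxz, hp⟩ := hpos
  suffices ∃ w, PositiveAt ξ w from
    PositiveAt.isPositiveMap hξ htrans (this.choose_spec.forall hξ htrans)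
  obtain ⟨s, hs, rfl⟩ := Circle.exists_eq_mul_exp_neg hxy
  obtain ⟨t, ht, rfl⟩ := Circle.exists_eq_mul_exp_neg hxz
  rcases lt_trichotomy s t with hst | rfl | hst
  · exact ⟨x, .of_exists hξ htrans hs ht hst hp⟩
  · exact absurd rfl hyz
  -- Here x, y, z are anticlockwise: inversion turns the angles s, t into 2π − s < 2π − t, and
  -- `PositiveAt.of_inv` returns to `ξ` with base point y.
  · refine ⟨_, PositiveAt.of_inv hξ htrans (x := x) ?_ hxy⟩
    have flip : ∀ u, (x⁻¹ * Circle.exp (-(2 * Real.pi - u)))⁻¹ = x * Circle.exp (-u) := by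
      intro u
      rw [mul_inv_rev, inv_inv, ← Circle.exp_neg, neg_neg, mul_comm, Circle.exp_sub,
        Circle.exp_two_pi, one_div, Circle.exp_neg]
    refine PositiveAt.of_exists (s₀ := 2 * Real.pi - s) (t₀ := 2 * Real.pi - t)
      (hξ.comp continuous_inv) htrans.comp_inv ⟨by linarith [hs.2], by linarith [hs.1]⟩
      ⟨by linarith [ht.2], by linarith [ht.1]⟩ (by linarith) ?_
    simpa only [Function.comp_apply, flip, inv_inv] using hp
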